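/- **Definitions.** Composition is written in diagrammatic order. An *inductive groupoid* is a groupoid with a partial order $\le$ on its arrows (objects being identified with identity arrows) such that: $x\le y$ implies $x^{-1}\le y^{-1}$; $x\le y$, $u\le v$ imply $xu\le yv$ when both composites exist; for every arrow $x$ and object $e\le \mathrm{dom}\,x$ there is a unique arrow $(e\,|\,x)\le x$ with domain $e$ (restriction), and for every object $e\le\mathrm{cod}\,x$ a unique arrow $(x\,|\,e)\le x$ with codomain $e$ (corestriction); and the objects form a meet-semilattice. A *double inductive groupoid* $\mathcal G$ is a (strict) double groupoid with objects $\mathrm{Obj}$, vertical arrows $\mathrm{Ver}$, horizontal arrows $\mathrm{Hor}$ and double cells $\mathrm{Dbl}$, with an inductive groupoid structure on $(\mathrm{Ver},\mathrm{Dbl})$ (horizontal composition $\circ$, order $\le$, meet $\wedge_h$ of vertical arrows, (co)restrictions $(e|a)$, $(a|e)$, (co)domains hdom, hcod) and one on $(\mathrm{Hor},\mathrm{Dbl})$ (vertical composition $\bullet$, order $\lesssim$, meet $\wedge_v$ of horizontal arrows, (co)restrictions $[f|a]$, $[a|f]$, (co)domains vdom, vcod), such that, identifying arrows and objects with their identity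 cells, the following hold whenever both sides are defined: 1. composition in one direction and (co)restriction in the other satisfy interchange: $(a\bullet b\,|\,f\bullet g)=(a|f)\bullet(b|g)$, $[a\circ b\,|\,f\circ g]=[a|f]\circ[b|g]$, and likewise for restrictions; 2. $(e\wedge_v f)\circ(g\wedge_v h)=(e\circ g)\wedge_v(f\circ h)$ for horizontal arrows and $(e\wedge_h f)\bullet(g\wedge_h h)=(e\bullet g)\wedge_h(f\bullet h)$ for vertical arrows; 3. meet and (co)restriction satisfy interchange: $(e|f)\wedge_v(g|h)=(e\wedge_v g\,|\,f\wedge_v h)$ for $e,g$ horizontal arrows and $f,h$ objects, $[e|f]\wedge_h[g|h]=[e\wedge_h g\,|\,f\wedge_h h]$ for $e,g$ vertical arrows and $f,h$ objects, and likewise for restrictions; 4. $([a|f]\,|\,[g|x])=[(a|g)\,|\,(f|x)]$ for a cell $a$, $f\in\mathrm{Hor}$, $g\in\mathrm{Ver}$, $x=f\,\mathrm{hcod}\wedge g\,\mathrm{vcod}$, and likewise for restrictions; 5. $(e\wedge_h f)\wedge_v(g\wedge_h h)=(e\wedge_v g)\wedge_h(f\wedge_v h)$ for objects; 6. vertical (co)domains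 preserve $\wedge_h$ of vertical arrows, and horizontal (co)domains preserve $\wedge_v$ of horizontal arrows; 7. vertical (co)domains preserve horizontal (co)restrictions, and horizontal (co)domains preserve vertical (co)restrictions, of cells. A *double inductive functor* is a double functor that preserves both partial orders and all meets. This gives the category $\mathbf{DIG}$. An object of $\mathbf{AbMeetSLatt}$ is a meet-semilattice $L$ with a functor $P:L^{\mathrm{op}}\to\mathbf{Ab}$; write $AP$ for its value at $A$ and $\varphi_{A\le B}:BP\to AP$ for its restriction maps. A morphism $(L,P)\to(L',P')$ is an order- and meet-preserving map $f:L\to L'$ with group homomorphisms $\psi_A:AP\to (Af)P'$ such that $\varphi_{A\le B};\psi_A=\psi_B;\varphi'_{Af\le Bf}$ for all $A\le B$. A *double inverse semigroup* is a set $S$ with two inverse semigroup operations $\circledcirc,\odot$ satisfying $(a\circledcirc b)\odot(c\circledcirc d)=(a\odot c)\circledcirc(b\odot d)$; the morphisms of the category $\mathbf{DIS}$ are the maps preserving both operations. (An inverse semigroup operation is an associative one for which every $a$ has exactly one $b$ with $aba=a$ and $bab=b$.) **Functors.** * $F:\mathbf{DIG}\to\mathbf{AbMeetSLatt}$ sends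 $\mathcal G$ to the presheaf $\mathcal S_{\mathcal G}$ on the meet-semilattice $\mathrm{Obj}(\mathcal G)$, where $(A)\mathcal S_{\mathcal G}$ is the set of double cells all of whose four corners are $A$, an Abelian group under composition, and $\varphi_{A\le B}(b)=(A|b)$. It sends a double inductive functor to its object function and the restrictions of its double cell function to the groups $(A)\mathcal S_{\mathcal G}$. * $F':\mathbf{AbMeetSLatt}\to\mathbf{DIG}$ sends $(L,P)$ to the double inductive groupoid with object set $L$, one vertical and one horizontal arrow $e_A:A\to A$ for each $A\in L$, and set of double cells the disjoint union $\coprod_{A\in L}AP$. A cell $a\in AP$ has all its (co)domains equal to $e_A$, composition in both directions is the group operation of $AP$, both orders are given by $a\le b$ iff $a=\varphi_{A\le B}(b)$ for $a\in AP$, $b\in BP$ with $A\le B$, $e_A\wedge e_B=e_{A\wedge B}$, and the (co)restriction of $a\in AP$ to $e_B$, $B\le A$, is $\varphi_{B\le A}(a)$. It sends $(f,\psi)$ to the double functor given by $f$ on objects and arrows and by the maps $\psi_A$ on cells. * $\mathbf{DIG}\to\mathbf{DIS}$ sends $\mathcal G$ to $\mathrm{Dbl}(\mathcal G)$ with $a\circledcirc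 b=(a\,|\,x)\circ(x\,|\,b)$, $x=a\,\mathrm{hcod}\wedge_h b\,\mathrm{hdom}$, and $a\odot b=[a\,|\,y]\bullet[y\,|\,b]$, $y=a\,\mathrm{vcod}\wedge_v b\,\mathrm{vdom}$, and a double inductive functor to its double cell function. * $\mathbf{DIS}\to\mathbf{DIG}$ sends $S$ to the double inductive groupoid with $\mathrm{Dbl}=S$, $\mathrm{Ver}=E(S,\circledcirc)$, $\mathrm{Hor}=E(S,\odot)$ (the sets of idempotents) and $\mathrm{Obj}=E(S,\circledcirc)\cap E(S,\odot)$, in which $a\,\mathrm{hdom}=a\circledcirc a^{\circledcirc}$, $a\,\mathrm{hcod}=a^{\circledcirc}\circledcirc a$ (where $a^{\circledcirc}$ is the $\circledcirc$-inverse of $a$), horizontal composition, meets and (co)restrictions are given by $\circledcirc$, and $a\le b$ iff $a=e\circledcirc b$ for some $e\in E(S,\circledcirc)$; the vertical structure is obtained in the same way from $\odot$. It acts on morphisms by restriction. **Theorem.** All four constructions are well defined functors, and the following hold. 1. The functors $F$ and $F'$ form an isomorphism of categories $\mathbf{DIG}\cong\mathbf{AbMeetSLatt}$, where each composite is the identity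 up to the canonical relabelling. That is, there are natural isomorphisms $\eta: FF'\Rightarrow \mathrm{id}_{\mathbf{DIG}}$ (first $F$, then $F'$) and $\varepsilon: F'F\Rightarrow\mathrm{id}_{\mathbf{AbMeetSLatt}}$ (first $F'$, then $F$) such that $\eta_{\mathcal G}$ is the identity on objects, sends each $e_A$ to the vertical, respectively horizontal, identity arrow of $A$, and sends the element $a$ of the summand $(A)\mathcal S_{\mathcal G}$ of $\coprod_A (A)\mathcal S_{\mathcal G}$ to the double cell $a$ of $\mathcal G$; and $\varepsilon_{(L,P)}$ is the identity on $L$ and sends the cell of $\coprod_{A}AP$ given by the element $a$ of the summand $AP$ to the element $a$ of $AP$. 2. Hence double inverse semigroups are exactly presheaves of Abelian groups on meet-semilattices. That is, the composite functors $\mathbf{DIS}\to\mathbf{DIG}\xrightarrow{F}\mathbf{AbMeetSLatt}$ and $\mathbf{AbMeetSLatt}\xrightarrow{F'}\mathbf{DIG}\to\mathbf{DIS}$ are mutually inverse in the same sense: there are natural isomorphisms from their two composites to the identity functors, whose component at a double inverse semigroup $S$ sends the element $a$ of the summand at $e$ of the disjoint union to $a\in S$, and whose component at $(L,P)$ sends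 the idempotent $0\in AP$ of $\coprod_A AP$ to $A\in L$ and the cell given by $a\in AP$ to $a$. -/

import Mathlib

open CategoryTheory Opposite

universe u

namespace DoubleInverse

/-! ### Groupoids and inductive groupoids with given sets of objects and arrows

Composition is written in diagrammatic order. -/

/-- A groupoid structure with set of objects `O` and set of arrows `A`. -/
structure GroupoidOn (O A : Type u) where
  dom : A → O
  cod : A → O
  id : O → A
  comp : (a b : A) → cod a = dom b → A
  inv : A → A
  dom_id : ∀ x, dom (id x) = x
  cod_id : ∀ x, cod (id x) = x
  dom_comp : ∀ a b h, dom (comp a b h) = dom a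
  cod_comp : ∀ a b h, cod (comp a b h) = cod b
  id_comp : ∀ a h, comp (id (dom a)) a h = a
  comp_id : ∀ a h, comp a (id (cod a)) h = a
  assoc : ∀ a b c h₁ h₂ h₃ h₄, comp (comp a b h₁) c h₂ = comp a (comp b c h₃) h₄
  dom_inv : ∀ a, dom (inv a) = cod a
  cod_inv : ∀ a, cod (inv a) = dom a
  comp_inv : ∀ a h, comp a (inv a) h = id (dom a)
  inv_comp : ∀ a h, comp (inv a) a h = id (cod a)

/-- A functor between groupoids, given by an object function and an arrow function. -/
structure GroupoidOn.IsFunctor {O A O' A' : Type u} (G : GroupoidOn O A) (G' : GroupoidOn O' A')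
    (f₀ : O → O') (f₁ : A → A') : Prop where
  dom : ∀ a, G'.dom (f₁ a) = f₀ (G.dom a)
  cod : ∀ a, G'.cod (f₁ a) = f₀ (G.cod a)
  id : ∀ x, f₁ (G.id x) = G'.id (f₀ x)
  comp : ∀ a b h h', f₁ (G.comp a b h) = G'.comp (f₁ a) (f₁ b) h'

/-- The structure that makes a groupoid an inductive groupoid: a partial order on the arrows,
compatible with inverses and composites, with unique restrictions and corestrictions, for which the
objects (identified with their identity arrows) form a meet-semilattice. -/
structure InductiveStr {O A : Type u} (G : GroupoidOn O A) where
  le : A → A → Prop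
  le_refl : ∀ x, le x x
  le_trans : ∀ x y z, le x y → le y z → le x z
  le_antisymm : ∀ x y, le x y → le y x → x = y
  inv_le : ∀ x y, le x y → le (G.inv x) (G.inv y)
  comp_le : ∀ x y u v hxu hyv, le x y → le u v → le (G.comp x u hxu) (G.comp y v hyv)
  /-- the restriction of the arrow `x` to the object `e` -/
  res : (e : O) → (x : A) → le (G.id e) (G.id (G.dom x)) → A
  res_le : ∀ e x h, le (res e x h) x
  dom_res : ∀ e x h, G.dom (res e x h) = e
  res_unique : ∀ e x h y, le y x → G.dom y = e → y = res e x h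
  /-- the corestriction of the arrow `x` to the object `e` -/
  cores : (x : A) → (e : O) → le (G.id e) (G.id (G.cod x)) → A
  cores_le : ∀ x e h, le (cores x e h) x
  cod_cores : ∀ x e h, G.cod (cores x e h) = e
  cores_unique : ∀ x e h y, le y x → G.cod y = e → y = cores x e h
  meet : O → O → O
  meet_le_left : ∀ e f, le (G.id (meet e f)) (G.id e)
  meet_le_right : ∀ e f, le (G.id (meet e f)) (G.id f)
  le_meet : ∀ e f g, le (G.id g) (G.id e) → le (G.id g) (G.id f) → le (G.id g) (G.id (meet e f))

/-- The order on objects, via their identity arrows. -/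
abbrev InductiveStr.objLe {O A : Type u} {G : GroupoidOn O A} (I : InductiveStr G) (e f : O) : Prop :=
  I.le (G.id e) (G.id f)

/-! ### Double inductive groupoids -/

/-- A (strict) double groupoid. Vertical arrows compose in `ver`, horizontal arrows in `hor`;
double cells compose horizontally in `hdbl` (whose objects are the vertical arrows) and vertically
in `vdbl` (whose objects are the horizontal arrows). -/
structure DoubleGroupoid where
  Obj : Type u
  Ver : Type u
  Hor : Type u
  Dbl : Type u
  ver : GroupoidOn Obj Ver
  hor : GroupoidOn Obj Hor
  hdbl : GroupoidOn Ver Dbl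
  vdbl : GroupoidOn Hor Dbl
  corner_dd : ∀ a, ver.dom (hdbl.dom a) = hor.dom (vdbl.dom a)
  corner_dc : ∀ a, ver.dom (hdbl.cod a) = hor.cod (vdbl.dom a)
  corner_cd : ∀ a, ver.cod (hdbl.dom a) = hor.dom (vdbl.cod a)
  corner_cc : ∀ a, ver.cod (hdbl.cod a) = hor.cod (vdbl.cod a)
  hdom_vcomp : ∀ a b h h', hdbl.dom (vdbl.comp a b h) = ver.comp (hdbl.dom a) (hdbl.dom b) h'
  hcod_vcomp : ∀ a b h h', hdbl.cod (vdbl.comp a b h) = ver.comp (hdbl.cod a) (hdbl.cod b) h'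
  vdom_hcomp : ∀ a b h h', vdbl.dom (hdbl.comp a b h) = hor.comp (vdbl.dom a) (vdbl.dom b) h'
  vcod_hcomp : ∀ a b h h', vdbl.cod (hdbl.comp a b h) = hor.comp (vdbl.cod a) (vdbl.cod b) h'
  vdom_hid : ∀ e, vdbl.dom (hdbl.id e) = hor.id (ver.dom e)
  vcod_hid : ∀ e, vdbl.cod (hdbl.id e) = hor.id (ver.cod e)
  hdom_vid : ∀ f, hdbl.dom (vdbl.id f) = ver.id (hor.dom f)
  hcod_vid : ∀ f, hdbl.cod (vdbl.id f) = ver.id (hor.cod f)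
  hid_comp : ∀ e f h h', hdbl.id (ver.comp e f h) = vdbl.comp (hdbl.id e) (hdbl.id f) h'
  vid_comp : ∀ e f h h', vdbl.id (hor.comp e f h) = hdbl.comp (vdbl.id e) (vdbl.id f) h'
  hid_id : ∀ A, hdbl.id (ver.id A) = vdbl.id (hor.id A)
  interchange : ∀ a b c d hab hcd hac hbd h h',
    vdbl.comp (hdbl.comp a b hab) (hdbl.comp c d hcd) h =
      hdbl.comp (vdbl.comp a c hac) (vdbl.comp b d hbd) h'

/-- A double groupoid both of whose groupoids of double cells are inductive, with no compatibility
between the two structures yet. -/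
structure BiorderedDoubleGroupoid extends DoubleGroupoid.{u} where
  /-- the inductive structure `≤` of `(Ver, Dbl)` -/
  hind : InductiveStr hdbl
  /-- the inductive structure `≲` of `(Hor, Dbl)` -/
  vind : InductiveStr vdbl

namespace BiorderedDoubleGroupoid

variable (G : BiorderedDoubleGroupoid.{u})

/-- `A ∧ₕ B` for objects, regarded as vertical arrows. -/
def objMeetH (A B : G.Obj) : G.Obj := G.ver.dom (G.hind.meet (G.ver.id A) (G.ver.id B))

/-- `A ∧ᵥ B` for objects, regarded as horizontal arrows. -/
def objMeetV (A B : G.Obj) : G.Obj := G.hor.dom (G.vind.meet (G.hor.id A) (G.hor.id B))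

/-- Horizontal restriction `(x |f)` of a horizontal arrow (a vertical identity cell) to an object. -/
def hresHor (x : G.Obj) (f : G.Hor)
    (h : G.hind.objLe (G.ver.id x) (G.hdbl.dom (G.vdbl.id f))) : G.Hor :=
  G.vdbl.dom (G.hind.res (G.ver.id x) (G.vdbl.id f) h)

/-- Horizontal corestriction `(f| x)` of a horizontal arrow to an object. -/
def hcoresHor (f : G.Hor) (x : G.Obj)
    (h : G.hind.objLe (G.ver.id x) (G.hdbl.cod (G.vdbl.id f))) : G.Hor :=
  G.vdbl.dom (G.hind.cores (G.vdbl.id f) (G.ver.id x) h)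

/-- Vertical restriction `[x |e]` of a vertical arrow (a horizontal identity cell) to an object. -/
def vresVer (x : G.Obj) (e : G.Ver)
    (h : G.vind.objLe (G.hor.id x) (G.vdbl.dom (G.hdbl.id e))) : G.Ver :=
  G.hdbl.dom (G.vind.res (G.hor.id x) (G.hdbl.id e) h)

/-- Vertical corestriction `[e| x]` of a vertical arrow to an object. -/
def vcoresVer (e : G.Ver) (x : G.Obj)
    (h : G.vind.objLe (G.hor.id x) (G.vdbl.cod (G.hdbl.id e))) : G.Ver :=
  G.hdbl.dom (G.vind.cores (G.hdbl.id e) (G.hor.id x) h)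

end BiorderedDoubleGroupoid

/-- Double inductive groupoids. Every law is required whenever both of its sides are defined, which
is what the quantified proofs `h`, `h'`, … express. -/
structure DoubleInductiveGroupoid extends BiorderedDoubleGroupoid.{u} where
  -- composition and (co)restriction
  hcores_vcomp : ∀ a b f g hab hfg hf hg h h',
    hind.cores (vdbl.comp a b hab) (ver.comp f g hfg) h =
      vdbl.comp (hind.cores a f hf) (hind.cores b g hg) h'
  vcores_hcomp : ∀ a b f g hab hfg hf hg h h',
    vind.cores (hdbl.comp a b hab) (hor.comp f g hfg) h =
      hdbl.comp (vind.cores a f hf) (vind.cores b g hg) h'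
  hres_vcomp : ∀ a b f g hab hfg hf hg h h',
    hind.res (ver.comp f g hfg) (vdbl.comp a b hab) h =
      vdbl.comp (hind.res f a hf) (hind.res g b hg) h'
  vres_hcomp : ∀ a b f g hab hfg hf hg h h',
    vind.res (hor.comp f g hfg) (hdbl.comp a b hab) h =
      hdbl.comp (vind.res f a hf) (vind.res g b hg) h'
  -- composition and meet
  vmeet_comp : ∀ e f g i heg hfi h,
    hor.comp (vind.meet e f) (vind.meet g i) h = vind.meet (hor.comp e g heg) (hor.comp f i hfi)
  hmeet_comp : ∀ e f g i heg hfi h,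
    ver.comp (hind.meet e f) (hind.meet g i) h = hind.meet (ver.comp e g heg) (ver.comp f i hfi)
  -- meet and (co)restriction
  vmeet_hcores : ∀ e f g i hf hi h,
    vind.meet (toBiorderedDoubleGroupoid.hcoresHor e f hf)
        (toBiorderedDoubleGroupoid.hcoresHor g i hi) =
      toBiorderedDoubleGroupoid.hcoresHor (vind.meet e g)
        (toBiorderedDoubleGroupoid.objMeetV f i) h
  hmeet_vcores : ∀ e f g i hf hi h,
    hind.meet (toBiorderedDoubleGroupoid.vcoresVer e f hf)
        (toBiorderedDoubleGroupoid.vcoresVer g i hi) =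
      toBiorderedDoubleGroupoid.vcoresVer (hind.meet e g)
        (toBiorderedDoubleGroupoid.objMeetH f i) h
  vmeet_hres : ∀ e f g i he hg h,
    vind.meet (toBiorderedDoubleGroupoid.hresHor e f he)
        (toBiorderedDoubleGroupoid.hresHor g i hg) =
      toBiorderedDoubleGroupoid.hresHor (toBiorderedDoubleGroupoid.objMeetV e g)
        (vind.meet f i) h
  hmeet_vres : ∀ e f g i he hg h,
    hind.meet (toBiorderedDoubleGroupoid.vresVer e f he)
        (toBiorderedDoubleGroupoid.vresVer g i hg) =
      toBiorderedDoubleGroupoid.vresVer (toBiorderedDoubleGroupoid.objMeetH e g)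
        (hind.meet f i) h
  -- horizontal and vertical (co)restriction; here `x` is the meet of the two inner corners
  cores_cores : ∀ a f g x, x = toBiorderedDoubleGroupoid.objMeetH (hor.cod f) (ver.cod g) →
    ∀ hf hg hgx hfx h h',
    hind.cores (vind.cores a f hf) (toBiorderedDoubleGroupoid.vcoresVer g x hgx) h =
      vind.cores (hind.cores a g hg) (toBiorderedDoubleGroupoid.hcoresHor f x hfx) h'
  res_res : ∀ a f g x, x = toBiorderedDoubleGroupoid.objMeetH (hor.dom f) (ver.dom g) →
    ∀ hf hg hgx hfx h h',
    hind.res (toBiorderedDoubleGroupoid.vresVer x g hgx) (vind.res f a hf) h =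
      vind.res (toBiorderedDoubleGroupoid.hresHor x f hfx) (hind.res g a hg) h'
  -- the two meets, on objects
  meet_meet : ∀ e f g i,
    toBiorderedDoubleGroupoid.objMeetV (toBiorderedDoubleGroupoid.objMeetH e f)
        (toBiorderedDoubleGroupoid.objMeetH g i) =
      toBiorderedDoubleGroupoid.objMeetH (toBiorderedDoubleGroupoid.objMeetV e g)
        (toBiorderedDoubleGroupoid.objMeetV f i)
  -- (co)domains and meets
  vdom_hmeet : ∀ e f, ver.id (ver.dom (hind.meet e f)) =
    hind.meet (ver.id (ver.dom e)) (ver.id (ver.dom f))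
  vcod_hmeet : ∀ e f, ver.id (ver.cod (hind.meet e f)) =
    hind.meet (ver.id (ver.cod e)) (ver.id (ver.cod f))
  hdom_vmeet : ∀ e f, hor.id (hor.dom (vind.meet e f)) =
    vind.meet (hor.id (hor.dom e)) (hor.id (hor.dom f))
  hcod_vmeet : ∀ e f, hor.id (hor.cod (vind.meet e f)) =
    vind.meet (hor.id (hor.cod e)) (hor.id (hor.cod f))
  -- (co)domains and (co)restrictions; both sides are identity cells
  vdom_hcores : ∀ a e h h', vdbl.id (vdbl.dom (hind.cores a e h)) =
    hind.cores (vdbl.id (vdbl.dom a)) (ver.id (ver.dom e)) h'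
  vcod_hcores : ∀ a e h h', vdbl.id (vdbl.cod (hind.cores a e h)) =
    hind.cores (vdbl.id (vdbl.cod a)) (ver.id (ver.cod e)) h'
  vdom_hres : ∀ e a h h', vdbl.id (vdbl.dom (hind.res e a h)) =
    hind.res (ver.id (ver.dom e)) (vdbl.id (vdbl.dom a)) h'
  vcod_hres : ∀ e a h h', vdbl.id (vdbl.cod (hind.res e a h)) =
    hind.res (ver.id (ver.cod e)) (vdbl.id (vdbl.cod a)) h'
  hdom_vcores : ∀ a e h h', hdbl.id (hdbl.dom (vind.cores a e h)) =
    vind.cores (hdbl.id (hdbl.dom a)) (hor.id (hor.dom e)) h'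
  hcod_vcores : ∀ a e h h', hdbl.id (hdbl.cod (vind.cores a e h)) =
    vind.cores (hdbl.id (hdbl.cod a)) (hor.id (hor.cod e)) h'
  hdom_vres : ∀ e a h h', hdbl.id (hdbl.dom (vind.res e a h)) =
    vind.res (hor.id (hor.dom e)) (hdbl.id (hdbl.dom a)) h'
  hcod_vres : ∀ e a h h', hdbl.id (hdbl.cod (vind.res e a h)) =
    vind.res (hor.id (hor.cod e)) (hdbl.id (hdbl.cod a)) h'

/-- Double inductive functors: double functors that preserve all partial orders and meets. -/
@[ext]
structure DoubleInductiveFunctor (G G' : DoubleInductiveGroupoid.{u}) where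
  onObj : G.Obj → G'.Obj
  onVer : G.Ver → G'.Ver
  onHor : G.Hor → G'.Hor
  onDbl : G.Dbl → G'.Dbl
  ver : G.ver.IsFunctor G'.ver onObj onVer
  hor : G.hor.IsFunctor G'.hor onObj onHor
  hdbl : G.hdbl.IsFunctor G'.hdbl onVer onDbl
  vdbl : G.vdbl.IsFunctor G'.vdbl onHor onDbl
  hle : ∀ a b, G.hind.le a b → G'.hind.le (onDbl a) (onDbl b)
  vle : ∀ a b, G.vind.le a b → G'.vind.le (onDbl a) (onDbl b)
  hmeet : ∀ e f, onVer (G.hind.meet e f) = G'.hind.meet (onVer e) (onVer f)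
  vmeet : ∀ e f, onHor (G.vind.meet e f) = G'.vind.meet (onHor e) (onHor f)

theorem GroupoidOn.IsFunctor.refl {O A : Type u} (G : GroupoidOn O A) :
    G.IsFunctor G (fun x => x) (fun x => x) :=
  ⟨fun _ => rfl, fun _ => rfl, fun _ => rfl, fun _ _ _ _ => rfl⟩

theorem GroupoidOn.IsFunctor.trans {O A O' A' O'' A'' : Type u} {G : GroupoidOn O A}
    {G' : GroupoidOn O' A'} {G'' : GroupoidOn O'' A''} {f₀ : O → O'} {f₁ : A → A'}
    {g₀ : O' → O''} {g₁ : A' → A''} (hf : G.IsFunctor G' f₀ f₁) (hg : G'.IsFunctor G'' g₀ g₁) :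
    G.IsFunctor G'' (fun x => g₀ (f₀ x)) (fun x => g₁ (f₁ x)) where
  dom a := by rw [hg.dom, hf.dom]
  cod a := by rw [hg.cod, hf.cod]
  id x := by rw [hf.id, hg.id]
  comp a b h h' := by
    have h₁ : G'.cod (f₁ a) = G'.dom (f₁ b) := by rw [hf.cod, hf.dom, h]
    rw [hf.comp a b h h₁, hg.comp _ _ h₁ h']

/-- The category of double inductive groupoids. -/
instance : Category DoubleInductiveGroupoid.{u} where
  Hom G G' := DoubleInductiveFunctor G G'
  id G :=
    { onObj := fun x => x, onVer := fun x => x, onHor := fun x => x, onDbl := fun x => x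
      ver := .refl _, hor := .refl _, hdbl := .refl _, vdbl := .refl _
      hle := fun _ _ h => h, vle := fun _ _ h => h
      hmeet := fun _ _ => rfl, vmeet := fun _ _ => rfl }
  comp f g :=
    { onObj := fun x => g.onObj (f.onObj x), onVer := fun x => g.onVer (f.onVer x)
      onHor := fun x => g.onHor (f.onHor x), onDbl := fun x => g.onDbl (f.onDbl x)
      ver := f.ver.trans g.ver, hor := f.hor.trans g.hor
      hdbl := f.hdbl.trans g.hdbl, vdbl := f.vdbl.trans g.vdbl
      hle := fun _ _ h => g.hle _ _ (f.hle _ _ h), vle := fun _ _ h => g.vle _ _ (f.vle _ _ h)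
      hmeet := fun _ _ => by rw [f.hmeet, g.hmeet]
      vmeet := fun _ _ => by rw [f.vmeet, g.vmeet] }

/-! ### A double inductive groupoid has only identity arrows

This is what makes the presheaf of a double inductive groupoid well defined. -/

theorem InductiveStr.id_le {O A : Type u} {G : GroupoidOn O A} (I : InductiveStr G) {x y : A}
    (h : I.le x y) : I.objLe (G.dom x) (G.dom y) := by
  have h1 := I.comp_le x y (G.inv x) (G.inv y) (G.dom_inv x).symm (G.dom_inv y).symm h
    (I.inv_le _ _ h)
  rwa [G.comp_inv, G.comp_inv] at h1

theorem InductiveStr.objLe_antisymm {O A : Type u} {G : GroupoidOn O A} (I : InductiveStr G)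
    {x y : O} (h : I.objLe x y) (h' : I.objLe y x) : x = y := by
  have := I.le_antisymm _ _ h h'
  rw [← G.dom_id x, this, G.dom_id]

theorem InductiveStr.meet_comm {O A : Type u} {G : GroupoidOn O A} (I : InductiveStr G)
    (x y : O) : I.meet x y = I.meet y x :=
  I.objLe_antisymm (I.le_meet _ _ _ (I.meet_le_right _ _) (I.meet_le_left _ _))
    (I.le_meet _ _ _ (I.meet_le_right _ _) (I.meet_le_left _ _))

theorem InductiveStr.meet_eq_left {O A : Type u} {G : GroupoidOn O A} (I : InductiveStr G)
    {x y : O} : I.meet x y = x ↔ I.objLe x y := by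
  constructor
  · intro h
    have := I.meet_le_right x y
    rw [h] at this
    exact this
  · intro h
    exact I.objLe_antisymm (I.meet_le_left _ _) (I.le_meet _ _ _ (I.le_refl _) h)

theorem InductiveStr.meet_self {O A : Type u} {G : GroupoidOn O A} (I : InductiveStr G)
    (x : O) : I.meet x x = x := I.meet_eq_left.2 (I.le_refl _)

theorem InductiveStr.meet_assoc {O A : Type u} {G : GroupoidOn O A} (I : InductiveStr G)
    (x y z : O) : I.meet (I.meet x y) z = I.meet x (I.meet y z) := by
  apply I.objLe_antisymm
  · refine I.le_meet _ _ _ (I.le_trans _ _ _ (I.meet_le_left _ _) (I.meet_le_left _ _)) ?_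
    exact I.le_meet _ _ _ (I.le_trans _ _ _ (I.meet_le_left _ _) (I.meet_le_right _ _))
      (I.meet_le_right _ _)
  · refine I.le_meet _ _ _ ?_ (I.le_trans _ _ _ (I.meet_le_right _ _) (I.meet_le_right _ _))
    exact I.le_meet _ _ _ (I.meet_le_left _ _)
      (I.le_trans _ _ _ (I.meet_le_right _ _) (I.meet_le_left _ _))

/-- A groupoid internal to semilattices with suitable restrictions has only identity arrows. -/
theorem GroupoidOn.eq_id_of_restriction {O A : Type u} (G : GroupoidOn O A)
    (m : A → A → A) (mo : O → O → O)
    (mcomm : ∀ a b, m a b = m b a) (midem : ∀ a, m a a = a)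
    (massoc : ∀ a b c, m (m a b) c = m a (m b c))
    (mocomm : ∀ x y, mo x y = mo y x) (moidem : ∀ x, mo x x = x)
    (moassoc : ∀ x y z, mo (mo x y) z = mo x (mo y z))
    (mdom : ∀ a b, G.dom (m a b) = mo (G.dom a) (G.dom b))
    (mcod : ∀ a b, G.cod (m a b) = mo (G.cod a) (G.cod b))
    (mcomp : ∀ a b c d h₁ h₂ h, G.comp (m a b) (m c d) h = m (G.comp a c h₁) (G.comp b d h₂))
    (r : ∀ x f, mo x (G.dom f) = x → A)
    (rdom : ∀ f h, r (G.dom f) f h = f) (rid : ∀ x y h, r x (G.id y) h = G.id x)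
    (rinj : ∀ f x y hx hy, G.cod (r x f hx) = G.cod (r y f hy) → x = y)
    (rmeet : ∀ x y f g hf hg h, m (r x f hf) (r y g hg) = r (mo x y) (m f g) h)
    (f : A) : f = G.id (G.dom f) := by
  -- endomorphisms are identities
  have endo : ∀ g e, G.dom g = e → G.cod g = e → m g (G.id e) = g ∧ m g (G.id e) = G.id e := by
    have key : ∀ g e, G.dom g = e → G.cod g = e → m g (G.id e) = G.id e := by
      intro g e hd hc
      set k := m (G.inv g) (G.id e) with hk
      set h := m g (G.id e) with hh
      have dk : G.cod k = e := by rw [hk, mcod, G.cod_inv, hd, G.cod_id, moidem]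
      have dh : G.dom h = e := by rw [hh, mdom, hd, G.dom_id, moidem]
      have e1 : G.comp k h (dk.trans dh.symm) = G.id e := by
        have := mcomp (G.inv g) (G.id e) g (G.id e) (by rw [G.cod_inv])
          (by rw [G.cod_id, G.dom_id]) (dk.trans dh.symm)
        have e3 := G.comp_id (G.id e) (by rw [G.cod_id, G.dom_id])
        have e4 := G.inv_comp g (by rw [G.cod_inv])
        rw [hc] at e4
        have e5 : G.comp (G.id e) (G.id e) (by rw [G.cod_id, G.dom_id]) = G.id e := by
          convert e3 using 2
          rw [G.cod_id]
        rw [this, e4, e5, midem]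
      have e2 : G.comp k g (dk.trans hd.symm) = h := by
        have := mcomp (G.inv g) (G.id e) g g (by rw [G.cod_inv])
          (by rw [G.cod_id, hd]) (by rw [midem]; exact dk.trans hd.symm)
        have e4 := G.inv_comp g (by rw [G.cod_inv])
        rw [hc] at e4
        have e5 : G.comp (G.id e) g (by rw [G.cod_id, hd]) = g := by
          convert G.id_comp g (by rw [G.cod_id]) using 2
          rw [hd]
        rw [e4, e5, mcomm (G.id e) g] at this
        refine Eq.trans ?_ this
        congr 1; exact (midem g).symm
      have e6 := mcomp k k h g (dk.trans dh.symm) (dk.trans hd.symm)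
        (by rw [midem, mdom, dh, hd, moidem, dk])
      have e7 : m h g = h := by rw [hh, massoc, mcomm (G.id e), ← massoc, midem]
      have e8 : G.comp (m k k) (m h g) (by rw [midem, mdom, dh, hd, moidem, dk]) = G.id e := by
        rw [← e1]; congr 1; exact midem k
      rw [e8, e1, e2] at e6
      rw [e6, hh, mcomm g, ← massoc, midem]
    intro g e hd hc
    have h1 := key g e hd hc
    have h2 := key (G.inv g) e (by rw [G.dom_inv, hc]) (by rw [G.cod_inv, hd])
    refine ⟨?_, h1⟩
    have e5 : G.comp (G.id e) g (by rw [G.cod_id, hd]) = g := by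
      convert G.id_comp g (by rw [G.cod_id]) using 2
      rw [hd]
    have := mcomp (G.inv g) (G.id e) g g (by rw [G.cod_inv])
          (by rw [G.cod_id, hd]) (by rw [midem, h2, G.cod_id, hd])
    have e4 := G.inv_comp g (by rw [G.cod_inv])
    rw [hc] at e4
    rw [e4, e5, mcomm (G.id e) g] at this
    rw [← this]
    have e9 : G.comp (m (G.inv g) (G.id e)) (m g g) (by rw [midem, h2, G.cod_id, hd])
        = G.comp (G.id e) g (by rw [G.cod_id, hd]) := by
      congr 1; exact midem g
    rw [e9, e5]
  -- the domain of an arrow lies below its codomain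
  have below : ∀ f, mo (G.cod f) (G.dom f) = G.dom f := by
    intro f
    set k := m f (G.id (G.dom f)) with hk
    have dk : G.dom k = G.dom f := by rw [hk, mdom, G.dom_id, moidem]
    have ck : G.cod k = mo (G.cod f) (G.dom f) := by rw [hk, mcod, G.cod_id]
    have mk : m (G.id (G.dom f)) k = k := by
      rw [hk, mcomm f, ← massoc, midem]
    -- the codomain of the restriction of `k` to `x` is the meet of `x` with the codomain of `k`
    have hr : ∀ x (hx : mo x (G.dom k) = x), G.cod (r x k hx) = mo x (G.cod k) := by
      intro x hx
      have hx' : mo x (G.dom f) = x := by rw [← dk]; exact hx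
      have := rmeet x (G.dom k) (G.id (G.dom f)) k (by rw [G.dom_id]; exact hx') (moidem _)
        (by rw [mk]; rw [moassoc, moidem])
      rw [rdom, rid] at this
      have h2 : r (mo x (G.dom k)) (m (G.id (G.dom f)) k) (by rw [mk]; rw [moassoc, moidem])
          = r x k hx := by congr 1
      rw [← h2, ← this, mcod, G.cod_id]
    have hc : mo (G.cod k) (G.dom k) = G.cod k := by
      rw [ck, dk, moassoc, moidem]
    have := rinj k (G.cod k) (G.dom k) hc (moidem _) (by
      rw [hr, hr, moidem, mocomm, hc])
    rw [← ck, this, dk]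
  have hcd : G.cod f = G.dom f := by
    have h1 := below f
    have h2 := below (G.inv f)
    rw [G.cod_inv, G.dom_inv, mocomm] at h2
    rw [← h1, h2]
  obtain ⟨h1, h2⟩ := endo f (G.dom f) rfl hcd
  rw [← h2]; exact h1.symm

namespace DoubleInductiveGroupoid

variable (G : DoubleInductiveGroupoid.{u})

theorem meetV_id (A B : G.Obj) :
    G.vind.meet (G.hor.id A) (G.hor.id B) = G.hor.id (G.objMeetV A B) := by
  have := G.hdom_vmeet (G.hor.id A) (G.hor.id B)
  rw [G.hor.dom_id, G.hor.dom_id] at this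
  exact this.symm

theorem meetH_id (A B : G.Obj) :
    G.hind.meet (G.ver.id A) (G.ver.id B) = G.ver.id (G.objMeetH A B) := by
  have := G.vdom_hmeet (G.ver.id A) (G.ver.id B)
  rw [G.ver.dom_id, G.ver.dom_id] at this
  exact this.symm

theorem objMeetV_comm (A B : G.Obj) : G.objMeetV A B = G.objMeetV B A := by
  rw [BiorderedDoubleGroupoid.objMeetV, InductiveStr.meet_comm]; rfl

theorem objMeetH_comm (A B : G.Obj) : G.objMeetH A B = G.objMeetH B A := by
  rw [BiorderedDoubleGroupoid.objMeetH, InductiveStr.meet_comm]; rfl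

theorem objMeetV_self (A : G.Obj) : G.objMeetV A A = A := by
  rw [BiorderedDoubleGroupoid.objMeetV, InductiveStr.meet_self, G.hor.dom_id]

theorem objMeetH_self (A : G.Obj) : G.objMeetH A A = A := by
  rw [BiorderedDoubleGroupoid.objMeetH, InductiveStr.meet_self, G.ver.dom_id]

theorem objMeetH_eq_objMeetV (A B : G.Obj) : G.objMeetH A B = G.objMeetV A B := by
  have := G.meet_meet A B B A
  rw [G.objMeetH_comm B A, G.objMeetV_self, G.objMeetV_comm B A, G.objMeetH_self] at this
  exact this

theorem objMeetV_assoc (A B C : G.Obj) :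
    G.objMeetV (G.objMeetV A B) C = G.objMeetV A (G.objMeetV B C) := by
  have : G.vind.meet (G.hor.id (G.objMeetV A B)) (G.hor.id C) =
      G.vind.meet (G.hor.id A) (G.hor.id (G.objMeetV B C)) := by
    rw [← meetV_id, ← meetV_id, InductiveStr.meet_assoc]
  rw [BiorderedDoubleGroupoid.objMeetV, this]; rfl

theorem objMeetH_assoc (A B C : G.Obj) :
    G.objMeetH (G.objMeetH A B) C = G.objMeetH A (G.objMeetH B C) := by
  simp only [objMeetH_eq_objMeetV, objMeetV_assoc]

theorem hle_iff (A B : G.Obj) :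
    G.hind.objLe (G.ver.id A) (G.ver.id B) ↔ G.objMeetH A B = A := by
  rw [← InductiveStr.meet_eq_left, meetH_id]
  exact ⟨fun h => by rw [← G.ver.dom_id (G.objMeetH A B), h, G.ver.dom_id], fun h => by rw [h]⟩

theorem vle_iff (A B : G.Obj) :
    G.vind.objLe (G.hor.id A) (G.hor.id B) ↔ G.objMeetV A B = A := by
  rw [← InductiveStr.meet_eq_left, meetV_id]
  exact ⟨fun h => by rw [← G.hor.dom_id (G.objMeetV A B), h, G.hor.dom_id], fun h => by rw [h]⟩

theorem hor_eq_id (f : G.Hor) : f = G.hor.id (G.hor.dom f) := by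
  have hle : ∀ x f, G.objMeetV x (G.hor.dom f) = x →
      G.hind.objLe (G.ver.id x) (G.hdbl.dom (G.vdbl.id f)) := by
    intro x f h
    rw [G.hdom_vid, hle_iff, objMeetH_eq_objMeetV, h]
  -- the restriction, as a cell, is a vertical identity
  have hcell : ∀ x f h, G.vdbl.id (G.hresHor x f h) =
      G.hind.res (G.ver.id x) (G.vdbl.id f) h := by
    intro x f h
    rw [BiorderedDoubleGroupoid.hresHor]
    have := G.vdom_hres (G.ver.id x) (G.vdbl.id f) h
      (by rw [G.vdbl.dom_id, G.ver.dom_id]; exact h)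
    rw [this]
    congr 1
    · rw [G.ver.dom_id]
    · rw [G.vdbl.dom_id]
  refine G.hor.eq_id_of_restriction G.vind.meet G.objMeetV G.vind.meet_comm G.vind.meet_self
    G.vind.meet_assoc G.objMeetV_comm G.objMeetV_self G.objMeetV_assoc ?_ ?_ ?_
    (fun x f h => G.hresHor x f (hle x f h)) ?_ ?_ ?_ ?_ f
  · intro a b
    have := G.hdom_vmeet a b
    rw [meetV_id] at this
    rw [← G.hor.dom_id (G.hor.dom _), this, G.hor.dom_id]
  · intro a b
    have := G.hcod_vmeet a b
    rw [meetV_id] at this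
    rw [← G.hor.dom_id (G.hor.cod _), this, G.hor.dom_id]
  · intro a b c d h₁ h₂ h
    exact G.vmeet_comp a b c d h₁ h₂ h
  · intro f h
    rw [← G.vdbl.dom_id (G.hresHor _ _ _), hcell]
    rw [← G.hind.res_unique _ _ _ (G.vdbl.id f) (G.hind.le_refl _) (G.hdom_vid f), G.vdbl.dom_id]
  · intro x y h
    rw [← G.vdbl.dom_id (G.hresHor _ _ _), hcell]
    rw [← G.hind.res_unique _ _ _ (G.vdbl.id (G.hor.id x)) ?_ ?_, G.vdbl.dom_id]
    · rw [← G.hid_id, ← G.hid_id]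
      rw [G.hor.dom_id] at h
      have : G.hind.objLe (G.ver.id x) (G.ver.id y) := by
        rw [hle_iff, objMeetH_eq_objMeetV, h]
      exact this
    · rw [G.hdom_vid, G.hor.dom_id]
  · intro f x y hx hy hc
    have h1 : G.hind.le (G.vdbl.id (G.hresHor x f (hle x f hx))) (G.vdbl.id f) := by
      rw [hcell]; exact G.hind.res_le _ _ _
    have h2 : G.hind.le (G.vdbl.id (G.hresHor y f (hle y f hy))) (G.vdbl.id f) := by
      rw [hcell]; exact G.hind.res_le _ _ _
    have hcc : G.hdbl.cod (G.vdbl.id (G.hresHor y f (hle y f hy))) =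
        G.hdbl.cod (G.vdbl.id (G.hresHor x f (hle x f hx))) := by
      rw [G.hcod_vid, G.hcod_vid, hc]
    have hl : G.hind.objLe (G.hdbl.cod (G.vdbl.id (G.hresHor x f (hle x f hx))))
        (G.hdbl.cod (G.vdbl.id f)) := by
      have := G.hind.id_le (G.hind.inv_le _ _ h1)
      rwa [G.hdbl.dom_inv, G.hdbl.dom_inv] at this
    have e1 := G.hind.cores_unique _ _ hl _ h1 rfl
    have e2 := G.hind.cores_unique _ _ hl _ h2 hcc
    have e3 := congrArg G.hdbl.dom (e1.trans e2.symm)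
    rw [hcell, hcell, G.hind.dom_res, G.hind.dom_res] at e3
    rw [← G.ver.dom_id x, e3, G.ver.dom_id]
  · intro x y f g hf hg h
    exact G.vmeet_hres x f y g _ _ _

theorem ver_eq_id (e : G.Ver) : e = G.ver.id (G.ver.dom e) := by
  have hle : ∀ x f, G.objMeetH x (G.ver.dom f) = x →
      G.vind.objLe (G.hor.id x) (G.vdbl.dom (G.hdbl.id f)) := by
    intro x f h
    rw [G.vdom_hid, vle_iff, ← objMeetH_eq_objMeetV, h]
  have hcell : ∀ x f h, G.hdbl.id (G.vresVer x f h) =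
      G.vind.res (G.hor.id x) (G.hdbl.id f) h := by
    intro x f h
    rw [BiorderedDoubleGroupoid.vresVer]
    have := G.hdom_vres (G.hor.id x) (G.hdbl.id f) h
      (by rw [G.hdbl.dom_id, G.hor.dom_id]; exact h)
    rw [this]
    congr 1
    · rw [G.hor.dom_id]
    · rw [G.hdbl.dom_id]
  refine G.ver.eq_id_of_restriction G.hind.meet G.objMeetH G.hind.meet_comm G.hind.meet_self
    G.hind.meet_assoc G.objMeetH_comm G.objMeetH_self G.objMeetH_assoc ?_ ?_ ?_
    (fun x f h => G.vresVer x f (hle x f h)) ?_ ?_ ?_ ?_ e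
  · intro a b
    have := G.vdom_hmeet a b
    rw [meetH_id] at this
    rw [← G.ver.dom_id (G.ver.dom _), this, G.ver.dom_id]
  · intro a b
    have := G.vcod_hmeet a b
    rw [meetH_id] at this
    rw [← G.ver.dom_id (G.ver.cod _), this, G.ver.dom_id]
  · intro a b c d h₁ h₂ h
    exact G.hmeet_comp a b c d h₁ h₂ h
  · intro f h
    rw [← G.hdbl.dom_id (G.vresVer _ _ _), hcell]
    rw [← G.vind.res_unique _ _ _ (G.hdbl.id f) (G.vind.le_refl _) (G.vdom_hid f), G.hdbl.dom_id]
  · intro x y h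
    rw [← G.hdbl.dom_id (G.vresVer _ _ _), hcell]
    rw [← G.vind.res_unique _ _ _ (G.hdbl.id (G.ver.id x)) ?_ ?_, G.hdbl.dom_id]
    · rw [G.hid_id, G.hid_id]
      rw [G.ver.dom_id] at h
      have : G.vind.objLe (G.hor.id x) (G.hor.id y) := by
        rw [vle_iff, ← objMeetH_eq_objMeetV, h]
      exact this
    · rw [G.vdom_hid, G.ver.dom_id]
  · intro f x y hx hy hc
    have h1 : G.vind.le (G.hdbl.id (G.vresVer x f (hle x f hx))) (G.hdbl.id f) := by
      rw [hcell]; exact G.vind.res_le _ _ _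
    have h2 : G.vind.le (G.hdbl.id (G.vresVer y f (hle y f hy))) (G.hdbl.id f) := by
      rw [hcell]; exact G.vind.res_le _ _ _
    have hcc : G.vdbl.cod (G.hdbl.id (G.vresVer y f (hle y f hy))) =
        G.vdbl.cod (G.hdbl.id (G.vresVer x f (hle x f hx))) := by
      rw [G.vcod_hid, G.vcod_hid, hc]
    have hl : G.vind.objLe (G.vdbl.cod (G.hdbl.id (G.vresVer x f (hle x f hx))))
        (G.vdbl.cod (G.hdbl.id f)) := by
      have := G.vind.id_le (G.vind.inv_le _ _ h1)
      rwa [G.vdbl.dom_inv, G.vdbl.dom_inv] at this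
    have e1 := G.vind.cores_unique _ _ hl _ h1 rfl
    have e2 := G.vind.cores_unique _ _ hl _ h2 hcc
    have e3 := congrArg G.vdbl.dom (e1.trans e2.symm)
    rw [hcell, hcell, G.vind.dom_res, G.vind.dom_res] at e3
    rw [← G.hor.dom_id x, e3, G.hor.dom_id]
  · intro x y f g hf hg h
    exact G.hmeet_vres x f y g _ _ _

/-- All four corners of a double cell coincide; this is the upper left one. -/
def corner (a : G.Dbl) : G.Obj := G.ver.dom (G.hdbl.dom a)

theorem hdom_eq (a : G.Dbl) : G.hdbl.dom a = G.ver.id (G.corner a) := G.ver_eq_id _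

theorem vdom_eq (a : G.Dbl) : G.vdbl.dom a = G.hor.id (G.corner a) := by
  rw [corner, G.corner_dd]; exact G.hor_eq_id _

theorem hcod_eq (a : G.Dbl) : G.hdbl.cod a = G.ver.id (G.corner a) := by
  rw [G.ver_eq_id (G.hdbl.cod a), G.corner_dc, vdom_eq, G.hor.cod_id]

theorem vcod_eq (a : G.Dbl) : G.vdbl.cod a = G.hor.id (G.corner a) := by
  rw [G.hor_eq_id (G.vdbl.cod a), ← G.corner_cd, hdom_eq, G.ver.cod_id]

theorem hcomposable {a b : G.Dbl} (h : G.corner a = G.corner b) : G.hdbl.cod a = G.hdbl.dom b := by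
  rw [hcod_eq, hdom_eq, h]

theorem vcomposable {a b : G.Dbl} (h : G.corner a = G.corner b) : G.vdbl.cod a = G.vdbl.dom b := by
  rw [vcod_eq, vdom_eq, h]

theorem corner_of_hdom {a : G.Dbl} {A : G.Obj} (h : G.hdbl.dom a = G.ver.id A) :
    G.corner a = A := by
  rw [corner, h, G.ver.dom_id]

theorem corner_of_vdom {a : G.Dbl} {A : G.Obj} (h : G.vdbl.dom a = G.hor.id A) :
    G.corner a = A := by
  rw [corner, G.corner_dd, h, G.hor.dom_id]

theorem corner_hcomp (a b : G.Dbl) (h) : G.corner (G.hdbl.comp a b h) = G.corner a := by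
  rw [corner, G.hdbl.dom_comp]; rfl

theorem corner_vcomp (a b : G.Dbl) (h) : G.corner (G.vdbl.comp a b h) = G.corner a := by
  rw [corner, G.corner_dd, G.vdbl.dom_comp, ← G.corner_dd]; rfl

theorem corner_hinv (a : G.Dbl) : G.corner (G.hdbl.inv a) = G.corner a := by
  apply corner_of_hdom; rw [G.hdbl.dom_inv, hcod_eq]

theorem corner_hid (A : G.Obj) : G.corner (G.hdbl.id (G.ver.id A)) = A := by
  apply corner_of_hdom; rw [G.hdbl.dom_id]

/-- The meet-semilattice of objects. -/
instance : SemilatticeInf G.Obj where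
  le A B := G.hind.objLe (G.ver.id A) (G.ver.id B)
  le_refl A := G.hind.le_refl _
  le_trans A B C := G.hind.le_trans _ _ _
  le_antisymm A B h h' := by
    have := G.hind.objLe_antisymm h h'
    rw [← G.ver.dom_id A, this, G.ver.dom_id]
  inf A B := G.objMeetH A B
  inf_le_left A B := by
    have := G.hind.meet_le_left (G.ver.id A) (G.ver.id B)
    rwa [meetH_id] at this
  inf_le_right A B := by
    have := G.hind.meet_le_right (G.ver.id A) (G.ver.id B)
    rwa [meetH_id] at this
  le_inf A B C h h' := by
    have := G.hind.le_meet (G.ver.id B) (G.ver.id C) (G.ver.id A) h h'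
    rwa [meetH_id] at this

/-- The set `(A)S_G` of double cells all of whose corners are `A`. -/
def CellsAt (A : G.Obj) : Type u :=
  { a : G.Dbl // G.ver.dom (G.hdbl.dom a) = A ∧ G.ver.dom (G.hdbl.cod a) = A ∧
    G.ver.cod (G.hdbl.dom a) = A ∧ G.ver.cod (G.hdbl.cod a) = A }

variable {G}

theorem CellsAt.corner_eq {A : G.Obj} (a : G.CellsAt A) : G.corner a.1 = A := a.2.1

/-- A double cell with upper left corner `A`, as an element of `(A)S_G`. -/
def CellsAt.mk {A : G.Obj} (a : G.Dbl) (h : G.corner a = A) : G.CellsAt A :=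
  ⟨a, h, by rw [hcod_eq, G.ver.dom_id, h], by rw [hdom_eq, G.ver.cod_id, h],
    by rw [hcod_eq, G.ver.cod_id, h]⟩

theorem CellsAt.ext {A : G.Obj} {a b : G.CellsAt A} (h : a.1 = b.1) : a = b := Subtype.ext h

/-- Addition in `(A)S_G` is horizontal composition. -/
instance (A : G.Obj) : Add (G.CellsAt A) where
  add a b := .mk (G.hdbl.comp a.1 b.1 (G.hcomposable (a.corner_eq.trans b.corner_eq.symm)))
    (by rw [corner_hcomp]; exact a.corner_eq)

instance (A : G.Obj) : Zero (G.CellsAt A) where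
  zero := .mk (G.hdbl.id (G.ver.id A)) (G.corner_hid A)

instance (A : G.Obj) : Neg (G.CellsAt A) where
  neg a := .mk (G.hdbl.inv a.1) (by rw [corner_hinv]; exact a.corner_eq)

/-- Vertical composition in `(A)S_G`. -/
def CellsAt.vadd {A : G.Obj} (a b : G.CellsAt A) : G.CellsAt A :=
  .mk (G.vdbl.comp a.1 b.1 (G.vcomposable (a.corner_eq.trans b.corner_eq.symm)))
    (by rw [corner_vcomp]; exact a.corner_eq)

theorem CellsAt.val_add {A : G.Obj} (a b : G.CellsAt A) (h) :
    (a + b).1 = G.hdbl.comp a.1 b.1 h := rfl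

theorem CellsAt.val_zero {A : G.Obj} : (0 : G.CellsAt A).1 = G.hdbl.id (G.ver.id A) := rfl

theorem _root_.DoubleInverse.GroupoidOn.comp_congr {O A : Type u} (G : GroupoidOn O A)
    {a a' b b' : A} (ha : a = a') (hb : b = b') (h h') : G.comp a b h = G.comp a' b' h' := by
  subst ha hb; rfl

theorem CellsAt.zero_add' {A : G.Obj} (a : G.CellsAt A) : 0 + a = a := by
  apply CellsAt.ext
  have := G.hdbl.id_comp a.1 (by rw [G.hdbl.cod_id])
  refine Eq.trans ?_ this
  refine G.hdbl.comp_congr ?_ rfl _ _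
  rw [val_zero, hdom_eq, a.corner_eq]

theorem CellsAt.add_zero' {A : G.Obj} (a : G.CellsAt A) : a + 0 = a := by
  apply CellsAt.ext
  have := G.hdbl.comp_id a.1 (by rw [G.hdbl.dom_id])
  refine Eq.trans ?_ this
  refine G.hdbl.comp_congr rfl ?_ _ _
  rw [val_zero, hcod_eq, a.corner_eq]

theorem CellsAt.zero_vadd {A : G.Obj} (a : G.CellsAt A) : vadd 0 a = a := by
  apply CellsAt.ext
  have := G.vdbl.id_comp a.1 (by rw [G.vdbl.cod_id])
  refine Eq.trans ?_ this
  refine G.vdbl.comp_congr ?_ rfl _ _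
  rw [val_zero, vdom_eq, a.corner_eq, G.hid_id]

theorem CellsAt.vadd_zero {A : G.Obj} (a : G.CellsAt A) : vadd a 0 = a := by
  apply CellsAt.ext
  have := G.vdbl.comp_id a.1 (by rw [G.vdbl.dom_id])
  refine Eq.trans ?_ this
  refine G.vdbl.comp_congr rfl ?_ _ _
  rw [val_zero, vcod_eq, a.corner_eq, G.hid_id]

theorem CellsAt.isUnital_add (A : G.Obj) :
    EckmannHilton.IsUnital (fun a b : G.CellsAt A => a + b) 0 :=
  { left_id := CellsAt.zero_add', right_id := CellsAt.add_zero' }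

theorem CellsAt.isUnital_vadd (A : G.Obj) :
    EckmannHilton.IsUnital (fun a b : G.CellsAt A => vadd a b) 0 :=
  { left_id := CellsAt.zero_vadd, right_id := CellsAt.vadd_zero }

theorem CellsAt.vadd_add {A : G.Obj} (a b c d : G.CellsAt A) :
    vadd (a + b) (c + d) = vadd a c + vadd b d := by
  apply CellsAt.ext
  exact G.interchange a.1 b.1 c.1 d.1 _ _ _ _ _ _

theorem CellsAt.vadd_eq_add {A : G.Obj} (a b : G.CellsAt A) : vadd a b = a + b :=
  congrFun (congrFun (EckmannHilton.mul (isUnital_vadd A) (isUnital_add A) vadd_add) a) b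

instance (A : G.Obj) : AddCommGroup (G.CellsAt A) :=
  { AddGroup.ofLeftAxioms (G := G.CellsAt A)
      (fun a b c => CellsAt.ext (G.hdbl.assoc a.1 b.1 c.1 _ _ _ _))
      CellsAt.zero_add'
      (fun a => CellsAt.ext (by
        have := G.hdbl.inv_comp a.1 (by rw [G.hdbl.cod_inv])
        refine Eq.trans this ?_
        rw [CellsAt.val_zero, hcod_eq, a.corner_eq])) with
    add_comm := fun a b =>
      (EckmannHilton.mul_comm (CellsAt.isUnital_vadd A) (CellsAt.isUnital_add A)
        CellsAt.vadd_add).comm a b }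

theorem CellsAt.le_hdom {A B : G.Obj} (h : A ≤ B) (b : G.CellsAt B) :
    G.hind.objLe (G.ver.id A) (G.hdbl.dom b.1) := by
  rw [hdom_eq, b.corner_eq]; exact h

/-- The restriction map `(B)S_G → (A)S_G`, `b ↦ (A |b)`, for `A ≤ B`. -/
def CellsAt.restrict {A B : G.Obj} (h : A ≤ B) (b : G.CellsAt B) : G.CellsAt A :=
  .mk (G.hind.res (G.ver.id A) b.1 (b.le_hdom h))
    (G.corner_of_hdom (G.hind.dom_res _ _ _))

theorem CellsAt.restrict_le {A B : G.Obj} (h : A ≤ B) (b : G.CellsAt B) :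
    G.hind.le (b.restrict h).1 b.1 := G.hind.res_le _ _ _

theorem CellsAt.eq_restrict {A B : G.Obj} (h : A ≤ B) (b : G.CellsAt B) (a : G.CellsAt A)
    (hab : G.hind.le a.1 b.1) : a = b.restrict h :=
  CellsAt.ext (G.hind.res_unique _ _ _ _ hab (by rw [hdom_eq, a.corner_eq]))

variable (G)

end DoubleInductiveGroupoid

/-- A presheaf of Abelian groups on a meet-semilattice. -/
structure AbMeetSLatt where
  L : Type u
  [semilattice : SemilatticeInf L]
  P : Lᵒᵖ ⥤ AddCommGrpCat.{u}

namespace AbMeetSLatt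

attribute [instance] semilattice

/-- The Abelian group `AP`. -/
abbrev fiber (X : AbMeetSLatt.{u}) (A : X.L) : Type u := X.P.obj (op A)

/-- The group homomorphism `φ_{A ≤ B} : BP → AP`. -/
def res (X : AbMeetSLatt.{u}) {A B : X.L} (h : A ≤ B) : X.fiber B →+ X.fiber A :=
  (X.P.map (homOfLE h).op).hom

theorem res_refl (X : AbMeetSLatt.{u}) {A : X.L} (h : A ≤ A) (a : X.fiber A) :
    X.res h a = a := by
  have : (homOfLE h).op = 𝟙 (op A) := rfl
  rw [res, this, X.P.map_id]; rfl

theorem res_res (X : AbMeetSLatt.{u}) {A B C : X.L} (h : A ≤ B) (h' : B ≤ C) (c : X.fiber C) :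
    X.res h (X.res h' c) = X.res (h.trans h') c := by
  have : (homOfLE (h.trans h')).op = (homOfLE h').op ≫ (homOfLE h).op := rfl
  rw [res, res, res, this, X.P.map_comp]; rfl

/-- A morphism of presheaves of Abelian groups on meet-semilattices. -/
structure Hom (X Y : AbMeetSLatt.{u}) where
  f : X.L → Y.L
  mono : Monotone f
  map_inf : ∀ A B, f (A ⊓ B) = f A ⊓ f B
  ψ : (A : X.L) → X.fiber A →+ Y.fiber (f A)
  comm : ∀ {A B : X.L} (h : A ≤ B) (b : X.fiber B), ψ A (X.res h b) = Y.res (mono h) (ψ B b)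

/-- The disjoint union of the groups `AP`. -/
abbrev Total (X : AbMeetSLatt.{u}) : Type u := Σ A : X.L, X.fiber A

theorem Hom.ext_total {X Y : AbMeetSLatt.{u}} {g g' : Hom X Y}
    (h : ∀ A (a : X.fiber A), (⟨g.f A, g.ψ A a⟩ : Y.Total) = ⟨g'.f A, g'.ψ A a⟩) : g = g' := by
  obtain ⟨f, _, _, ψ, _⟩ := g
  obtain ⟨f', _, _, ψ', _⟩ := g'
  have hf : f = f' := funext fun A => congrArg Sigma.fst (h A 0)
  subst hf
  have : ψ = ψ' := by
    funext A
    ext a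
    simpa using h A a
  subst this
  rfl

theorem Total.ext {X : AbMeetSLatt.{u}} {A B : X.L} {a : X.fiber A} {b : X.fiber B} (h : A = B)
    (h' : a = X.res h.le b) : (⟨A, a⟩ : X.Total) = ⟨B, b⟩ := by
  subst h
  rw [h', res_refl]

/-- The category of presheaves of Abelian groups on meet-semilattices. -/
instance : Category AbMeetSLatt.{u} where
  Hom X Y := Hom X Y
  id X :=
    { f := fun A => A, mono := fun _ _ h => h, map_inf := fun _ _ => rfl
      ψ := fun _ => AddMonoidHom.id _, comm := fun _ _ => rfl }
  comp g k :=
    { f := fun A => k.f (g.f A), mono := fun _ _ h => k.mono (g.mono h)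
      map_inf := fun A B => by rw [g.map_inf, k.map_inf]
      ψ := fun A => (k.ψ (g.f A)).comp (g.ψ A)
      comm := fun h b => by
        rw [AddMonoidHom.comp_apply, AddMonoidHom.comp_apply, g.comm h, k.comm (g.mono h)] }

end AbMeetSLatt

namespace DoubleInductiveGroupoid

/-- The presheaf `S_G` of Abelian groups on the meet-semilattice of objects of `G`. -/
def toPresheaf (G : DoubleInductiveGroupoid.{u}) : AbMeetSLatt.{u} where
  L := G.Obj
  P :=
    { obj := fun A => AddCommGrpCat.of (G.CellsAt A.unop)
      map := fun {B A} h => AddCommGrpCat.ofHom <| AddMonoidHom.mk'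
        (fun b : G.CellsAt B.unop => b.restrict h.unop.le) (fun a b => by
          refine (CellsAt.eq_restrict _ _ _ ?_).symm
          exact G.hind.comp_le _ _ _ _ _ _ (a.restrict_le _) (b.restrict_le _))
      map_id := fun A => by
        ext a
        exact (CellsAt.eq_restrict (le_refl A.unop) a a (G.hind.le_refl _)).symm
      map_comp := fun {C B A} h k => by
        ext c
        exact (CellsAt.eq_restrict (h ≫ k).unop.le c
          (CellsAt.restrict k.unop.le (CellsAt.restrict h.unop.le c))
          (G.hind.le_trans _ _ _ (CellsAt.restrict_le _ _) (CellsAt.restrict_le _ _))).symm }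

/-- Restriction of the double cell function of `F` to the cells at `A`. -/
def CellsAt.map {G G' : DoubleInductiveGroupoid.{u}} (F : G ⟶ G') (A : G.Obj) :
    G.CellsAt A →+ G'.CellsAt (F.onObj A) :=
  AddMonoidHom.mk' (fun a => ⟨F.onDbl a.1, by
    obtain ⟨h1, h2, h3, h4⟩ := a.2
    refine ⟨?_, ?_, ?_, ?_⟩
    · rw [F.hdbl.dom, F.ver.dom, h1]
    · rw [F.hdbl.cod, F.ver.dom, h2]
    · rw [F.hdbl.dom, F.ver.cod, h3]
    · rw [F.hdbl.cod, F.ver.cod, h4]⟩)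
    (fun a b => CellsAt.ext (F.hdbl.comp a.1 b.1 _ _))

theorem onObj_mono {G G' : DoubleInductiveGroupoid.{u}} (F : G ⟶ G') {A B : G.Obj} (h : A ≤ B) :
    F.onObj A ≤ F.onObj B := by
  have := F.hle _ _ h
  rw [F.hdbl.id, F.hdbl.id, F.ver.id, F.ver.id] at this
  exact this

theorem onObj_inf {G G' : DoubleInductiveGroupoid.{u}} (F : G ⟶ G') (A B : G.Obj) :
    F.onObj (A ⊓ B) = F.onObj A ⊓ F.onObj B := by
  change F.onObj (G.objMeetH A B) = G'.objMeetH (F.onObj A) (F.onObj B)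
  rw [BiorderedDoubleGroupoid.objMeetH, ← F.ver.dom, F.hmeet, F.ver.id, F.ver.id]; rfl

theorem CellsAt.map_restrict {G G' : DoubleInductiveGroupoid.{u}} (F : G ⟶ G') {A B : G.Obj}
    (h : A ≤ B) (b : G.CellsAt B) :
    CellsAt.map F A (b.restrict h) = (CellsAt.map F B b).restrict (onObj_mono F h) :=
  CellsAt.eq_restrict _ _ _ (F.hle _ _ (CellsAt.restrict_le h b))

end DoubleInductiveGroupoid

/-- The functor from double inductive groupoids to presheaves of Abelian groups on
meet-semilattices: it sends `G` to `S_G`, and a double inductive functor to its object function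
together with the restrictions of its double cell function. -/
def digToPresheaf : DoubleInductiveGroupoid.{u} ⥤ AbMeetSLatt.{u} where
  obj G := G.toPresheaf
  map {G G'} F :=
    { f := F.onObj
      mono := fun _ _ h => DoubleInductiveGroupoid.onObj_mono F h
      map_inf := fun A B => DoubleInductiveGroupoid.onObj_inf F A B
      ψ := fun A => DoubleInductiveGroupoid.CellsAt.map F A
      comm := fun h b => DoubleInductiveGroupoid.CellsAt.map_restrict F h b }

/-! ### From presheaves to double inductive groupoids -/

namespace AbMeetSLatt

variable (X : AbMeetSLatt.{u})

/-- The groupoid of identity arrows `e_A : A → A`, where the unit `e_A` of `AP` is recorded by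
`A`. -/
abbrev arrows : GroupoidOn X.L X.L where
  dom A := A
  cod A := A
  id A := A
  comp A _ _ := A
  inv A := A
  dom_id _ := rfl
  cod_id _ := rfl
  dom_comp _ _ _ := rfl
  cod_comp _ _ h := h
  id_comp _ _ := rfl
  comp_id _ _ := rfl
  assoc _ _ _ _ _ _ _ := rfl
  dom_inv _ := rfl
  cod_inv _ := rfl
  comp_inv _ _ := rfl
  inv_comp _ _ := rfl

/-- The groupoid of elements of the groups `AP`, with two elements composable when they lie in the
same group. -/
abbrev cells : GroupoidOn X.L X.Total where
  dom a := a.1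
  cod a := a.1
  id A := ⟨A, 0⟩
  comp a b h := ⟨a.1, a.2 + X.res (le_of_eq h) b.2⟩
  inv a := ⟨a.1, -a.2⟩
  dom_id _ := rfl
  cod_id _ := rfl
  dom_comp _ _ _ := rfl
  cod_comp _ _ h := h
  id_comp a h := by rw [zero_add, res_refl]
  comp_id a h := by rw [map_zero, add_zero]
  assoc a b c h₁ h₂ h₃ h₄ := by rw [map_add, res_res, add_assoc]
  dom_inv _ := rfl
  cod_inv _ := rfl
  comp_inv a h := by rw [res_refl, add_neg_cancel]
  inv_comp a h := by rw [res_refl, neg_add_cancel]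

/-- The inductive structure: `a ≤ b` if `a` is a restriction of `b`. -/
abbrev cellsInd : InductiveStr X.cells where
  le a b := ∃ h : a.1 ≤ b.1, a.2 = X.res h b.2
  le_refl a := ⟨le_refl _, by rw [res_refl]⟩
  le_trans a b c := by
    rintro ⟨h, e⟩ ⟨h', e'⟩
    exact ⟨h.trans h', by rw [e, e', res_res]⟩
  le_antisymm a b := by
    rintro ⟨h, e⟩ ⟨h', e'⟩
    exact Total.ext (le_antisymm h h') e
  inv_le a b := by
    rintro ⟨h, e⟩
    exact ⟨h, by change -a.2 = X.res h (-b.2); rw [e, map_neg]⟩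
  comp_le x y u v hxu hyv := by
    rintro ⟨h, e⟩ ⟨h', e'⟩
    refine ⟨h, ?_⟩
    change x.2 + X.res _ u.2 = X.res h (y.2 + X.res _ v.2)
    rw [map_add, res_res, ← e, e', res_res]
  res A a h := ⟨A, X.res (h.elim fun h _ => h) a.2⟩
  res_le A a h := ⟨_, rfl⟩
  dom_res _ _ _ := rfl
  res_unique A a h b := by
    rintro ⟨h', e⟩ rfl
    exact Total.ext rfl (by rw [e, res_res])
  cores a A h := ⟨A, X.res (h.elim fun h _ => h) a.2⟩
  cores_le a A h := ⟨_, rfl⟩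
  cod_cores _ _ _ := rfl
  cores_unique a A h b := by
    rintro ⟨h', e⟩ rfl
    exact Total.ext rfl (by rw [e, res_res])
  meet A B := A ⊓ B
  meet_le_left A B := ⟨inf_le_left, (map_zero _).symm⟩
  meet_le_right A B := ⟨inf_le_right, (map_zero _).symm⟩
  le_meet A B C := by
    rintro ⟨h, _⟩ ⟨h', _⟩
    exact ⟨le_inf h h', (map_zero _).symm⟩

/-- The double inductive groupoid of a presheaf of Abelian groups on a meet-semilattice. -/
def toDoubleInductiveGroupoid : DoubleInductiveGroupoid.{u} where
  Obj := X.L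
  Ver := X.L
  Hor := X.L
  Dbl := X.Total
  ver := X.arrows
  hor := X.arrows
  hdbl := X.cells
  vdbl := X.cells
  corner_dd _ := rfl
  corner_dc _ := rfl
  corner_cd _ := rfl
  corner_cc _ := rfl
  hdom_vcomp _ _ _ _ := rfl
  hcod_vcomp _ _ _ _ := rfl
  vdom_hcomp _ _ _ _ := rfl
  vcod_hcomp _ _ _ _ := rfl
  vdom_hid _ := rfl
  vcod_hid _ := rfl
  hdom_vid _ := rfl
  hcod_vid _ := rfl
  hid_comp e f h h' := Total.ext rfl (by simp)
  vid_comp e f h h' := Total.ext rfl (by simp)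
  hid_id _ := rfl
  interchange a b c d hab hcd hac hbd h h' := by
    refine Total.ext rfl ?_
    change a.2 + X.res _ b.2 + X.res _ (c.2 + X.res _ d.2) =
      X.res _ (a.2 + X.res _ c.2 + X.res _ (b.2 + X.res _ d.2))
    simp only [map_add, res_res, res_refl]
    abel
  hind := X.cellsInd
  vind := X.cellsInd
  hcores_vcomp a b f g hab hfg hf hg h h' := Total.ext rfl (by
    change X.res _ (a.2 + X.res _ b.2) = X.res _ (X.res _ a.2 + X.res _ (X.res _ b.2))
    simp only [map_add, res_res])
  vcores_hcomp a b f g hab hfg hf hg h h' := Total.ext rfl (by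
    change X.res _ (a.2 + X.res _ b.2) = X.res _ (X.res _ a.2 + X.res _ (X.res _ b.2))
    simp only [map_add, res_res])
  hres_vcomp a b f g hab hfg hf hg h h' := Total.ext rfl (by
    change X.res _ (a.2 + X.res _ b.2) = X.res _ (X.res _ a.2 + X.res _ (X.res _ b.2))
    simp only [map_add, res_res])
  vres_hcomp a b f g hab hfg hf hg h h' := Total.ext rfl (by
    change X.res _ (a.2 + X.res _ b.2) = X.res _ (X.res _ a.2 + X.res _ (X.res _ b.2))
    simp only [map_add, res_res])
  vmeet_comp _ _ _ _ _ _ _ := rfl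
  hmeet_comp _ _ _ _ _ _ _ := rfl
  vmeet_hcores _ _ _ _ _ _ _ := rfl
  hmeet_vcores _ _ _ _ _ _ _ := rfl
  vmeet_hres _ _ _ _ _ _ _ := rfl
  hmeet_vres _ _ _ _ _ _ _ := rfl
  cores_cores a f g x hx hf hg hgx hfx h h' := Total.ext rfl (by
    change X.res _ (X.res _ a.2) = X.res _ (X.res _ (X.res _ a.2))
    simp only [res_res])
  res_res a f g x hx hf hg hgx hfx h h' := Total.ext rfl (by
    change X.res _ (X.res _ a.2) = X.res _ (X.res _ (X.res _ a.2))
    simp only [res_res])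
  meet_meet e f g i := inf_inf_inf_comm e f g i
  vdom_hmeet _ _ := rfl
  vcod_hmeet _ _ := rfl
  hdom_vmeet _ _ := rfl
  hcod_vmeet _ _ := rfl
  vdom_hcores _ _ _ _ := Total.ext rfl (by simp)
  vcod_hcores _ _ _ _ := Total.ext rfl (by simp)
  vdom_hres _ _ _ _ := Total.ext rfl (by simp)
  vcod_hres _ _ _ _ := Total.ext rfl (by simp)
  hdom_vcores _ _ _ _ := Total.ext rfl (by simp)
  hcod_vcores _ _ _ _ := Total.ext rfl (by simp)
  hdom_vres _ _ _ _ := Total.ext rfl (by simp)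
  hcod_vres _ _ _ _ := Total.ext rfl (by simp)

variable {X}

/-- The function on disjoint unions induced by a morphism of presheaves. -/
abbrev Hom.total {X Y : AbMeetSLatt.{u}} (g : Hom X Y) (a : X.Total) : Y.Total :=
  ⟨g.f a.1, g.ψ a.1 a.2⟩

theorem Hom.isFunctor_arrows {X Y : AbMeetSLatt.{u}} (g : Hom X Y) :
    X.arrows.IsFunctor Y.arrows g.f g.f :=
  ⟨fun _ => rfl, fun _ => rfl, fun _ => rfl, fun _ _ _ _ => rfl⟩

theorem Hom.isFunctor_cells {X Y : AbMeetSLatt.{u}} (g : Hom X Y) :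
    X.cells.IsFunctor Y.cells g.f g.total where
  dom _ := rfl
  cod _ := rfl
  id A := Total.ext rfl (by
    change g.ψ A 0 = Y.res _ 0
    rw [map_zero, map_zero])
  comp a b h h' := Total.ext rfl (by
    change g.ψ a.1 (a.2 + X.res _ b.2) = Y.res _ (g.ψ a.1 a.2 + Y.res _ (g.ψ b.1 b.2))
    rw [map_add, g.comm, res_refl])

theorem Hom.total_le {X Y : AbMeetSLatt.{u}} (g : Hom X Y) (a b : X.Total)
    (h : X.cellsInd.le a b) : Y.cellsInd.le (g.total a) (g.total b) := by
  obtain ⟨h, e⟩ := h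
  exact ⟨g.mono h, by
    change g.ψ a.1 a.2 = Y.res _ (g.ψ b.1 b.2)
    rw [e, g.comm]⟩

end AbMeetSLatt

/-- The functor from presheaves of Abelian groups on meet-semilattices to double inductive
groupoids. -/
def presheafToDig : AbMeetSLatt.{u} ⥤ DoubleInductiveGroupoid.{u} where
  obj X := X.toDoubleInductiveGroupoid
  map {X Y} g :=
    { onObj := g.f
      onVer := g.f
      onHor := g.f
      onDbl := AbMeetSLatt.Hom.total g
      ver := g.isFunctor_arrows
      hor := g.isFunctor_arrows
      hdbl := g.isFunctor_cells
      vdbl := g.isFunctor_cells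
      hle := g.total_le
      vle := g.total_le
      hmeet := g.map_inf
      vmeet := g.map_inf }

/-! ### Double inverse semigroups -/

/-- `m` is the operation of an inverse semigroup. -/
def IsInverseOp {S : Type u} (m : S → S → S) : Prop :=
  (∀ a b c, m (m a b) c = m a (m b c)) ∧ ∀ a, ∃! b, m (m a b) a = a ∧ m (m b a) b = b

/-- A double inverse semigroup, with operations `h` (written `⊚`) and `v` (written `⊙`). -/
structure DoubleInverseSemigroup where
  S : Type u
  h : S → S → S
  v : S → S → S
  h_inverse : IsInverseOp h
  v_inverse : IsInverseOp v
  interchange : ∀ a b c d, v (h a b) (h c d) = h (v a c) (v b d)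

/-- Double semigroup homomorphisms. -/
@[ext]
structure DoubleInverseSemigroup.Hom (S T : DoubleInverseSemigroup.{u}) where
  f : S.S → T.S
  map_h : ∀ a b, f (S.h a b) = T.h (f a) (f b)
  map_v : ∀ a b, f (S.v a b) = T.v (f a) (f b)

/-- The category of double inverse semigroups. -/
instance : Category DoubleInverseSemigroup.{u} where
  Hom S T := DoubleInverseSemigroup.Hom S T
  id S := ⟨fun a => a, fun _ _ => rfl, fun _ _ => rfl⟩
  comp f g := ⟨fun a => g.f (f.f a), fun a b => by rw [f.map_h, g.map_h],
    fun a b => by rw [f.map_v, g.map_v]⟩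

theorem isInverseOp_of_comm {S : Type u} {m : S → S → S}
    (assoc : ∀ a b c, m (m a b) c = m a (m b c)) (comm : ∀ a b, m a b = m b a)
    (inv : ∀ a, ∃ b, m (m a b) a = a ∧ m (m b a) b = b) : IsInverseOp m := by
  refine ⟨assoc, fun a => ?_⟩
  obtain ⟨b, h1, h2⟩ := inv a
  refine ⟨b, ⟨h1, h2⟩, ?_⟩
  have key : ∀ b c, m (m a b) a = a → m (m b a) b = b → m (m a c) a = a → b = m (m b a) c := by
    intro b c _ h2 h3
    have e : m (m b (m (m a c) a)) b = m (m (m b a) b) (m a c) := by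
      have : Std.Associative m := ⟨assoc⟩
      have : Std.Commutative m := ⟨comm⟩
      ac_rfl
    rw [h3, h2] at e
    rw [assoc]; exact e
  rintro c ⟨h3, h4⟩
  rw [key b c h1 h2 h3]
  have := key c b h3 h4 h1
  have e : m (m c a) b = m (m b a) c := by
    have : Std.Associative m := ⟨assoc⟩
    have : Std.Commutative m := ⟨comm⟩
    ac_rfl
  exact this.trans e

/-- The semigroup product `a ⊗ b = (a| cod a ∧ dom b) (cod a ∧ dom b |b)` of an inductive
groupoid. -/
def InductiveStr.prod {O A : Type u} {G : GroupoidOn O A} (I : InductiveStr G) (a b : A) : A :=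
  G.comp (I.cores a (I.meet (G.cod a) (G.dom b)) (I.meet_le_left _ _))
    (I.res (I.meet (G.cod a) (G.dom b)) b (I.meet_le_right _ _))
    (by rw [I.cod_cores, I.dom_res])

theorem InductiveStr.map_prod {O A O' A' : Type u} {G : GroupoidOn O A} {G' : GroupoidOn O' A'}
    (I : InductiveStr G) (I' : InductiveStr G') {f₀ : O → O'} {f₁ : A → A'}
    (hf : G.IsFunctor G' f₀ f₁) (hle : ∀ a b, I.le a b → I'.le (f₁ a) (f₁ b))
    (hm : ∀ e f, f₀ (I.meet e f) = I'.meet (f₀ e) (f₀ f)) (a b : A) :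
    f₁ (I.prod a b) = I'.prod (f₁ a) (f₁ b) := by
  have e : f₀ (I.meet (G.cod a) (G.dom b)) = I'.meet (G'.cod (f₁ a)) (G'.dom (f₁ b)) := by
    rw [hm, hf.cod, hf.dom]
  rw [prod, hf.comp _ _ _ (by rw [hf.cod, hf.dom, I.cod_cores, I.dom_res]), prod]
  refine G'.comp_congr ?_ ?_ _ _
  · exact I'.cores_unique _ _ _ _ (hle _ _ (I.cores_le _ _ _)) (by rw [hf.cod, I.cod_cores, e])
  · exact I'.res_unique _ _ _ _ (hle _ _ (I.res_le _ _ _)) (by rw [hf.dom, I.dom_res, e])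

namespace AbMeetSLatt

variable (X : AbMeetSLatt.{u})

/-- The product on the disjoint union of the groups `AP`. -/
abbrev mul (a b : X.Total) : X.Total := ⟨a.1 ⊓ b.1, X.res inf_le_left a.2 + X.res inf_le_right b.2⟩

theorem mul_comm (a b : X.Total) : X.mul a b = X.mul b a :=
  Total.ext (inf_comm _ _) (by simp only [map_add, res_res, add_comm])

theorem mul_assoc (a b c : X.Total) : X.mul (X.mul a b) c = X.mul a (X.mul b c) :=
  Total.ext (inf_assoc _ _ _) (by simp only [mul, map_add, res_res, add_assoc])

theorem mul_inv (a : X.Total) : X.mul (X.mul a ⟨a.1, -a.2⟩) a = a :=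
  Total.ext (by simp) (by simp)

theorem inv_mul (a : X.Total) :
    X.mul (X.mul ⟨a.1, -a.2⟩ a) ⟨a.1, -a.2⟩ = ⟨a.1, -a.2⟩ :=
  Total.ext (by simp) (by simp)

end AbMeetSLatt

namespace DoubleInductiveGroupoid

variable (G : DoubleInductiveGroupoid.{u})

/-- A double cell, as an element of the disjoint union of the groups `(A)S_G`. -/
def toTotal (a : G.Dbl) : G.toPresheaf.Total := ⟨G.corner a, CellsAt.mk a rfl⟩

theorem toTotal_injective : Function.Injective G.toTotal := by
  have : ∀ a, ((G.toTotal a).2 : G.CellsAt _).1 = a := fun _ => rfl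
  intro a b h
  rw [← this a, h, this]

theorem toTotal_val {A : G.Obj} (a : G.CellsAt A) : G.toTotal a.1 = ⟨A, a⟩ := by
  obtain ⟨a, rfl, h⟩ := a
  rfl

theorem vres_eq_hres (A : G.Obj) (a : G.Dbl) (h h') :
    G.vind.res (G.hor.id A) a h = G.hind.res (G.ver.id A) a h' := by
  have c1 : G.corner (G.vind.res (G.hor.id A) a h) = A :=
    G.corner_of_vdom (G.vind.dom_res _ _ _)
  have c2 : G.corner (G.hind.res (G.ver.id A) a h') = A :=
    G.corner_of_hdom (G.hind.dom_res _ _ _)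
  have hg : G.vind.objLe (G.hor.id A) (G.vdbl.dom (G.hdbl.id (G.ver.id A))) := by
    rw [G.vdom_hid, G.ver.dom_id]; exact G.vind.le_refl _
  have hf : G.hind.objLe (G.ver.id A) (G.hdbl.dom (G.vdbl.id (G.hor.id A))) := by
    rw [G.hdom_vid, G.hor.dom_id]; exact G.hind.le_refl _
  have eg : G.vresVer A (G.ver.id A) hg = G.ver.id A := by
    rw [BiorderedDoubleGroupoid.vresVer, hdom_eq, G.corner_of_vdom (G.vind.dom_res _ _ _)]
  have ef : G.hresHor A (G.hor.id A) hf = G.hor.id A := by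
    rw [BiorderedDoubleGroupoid.hresHor, vdom_eq, G.corner_of_hdom (G.hind.dom_res _ _ _)]
  have l1 : G.hind.objLe (G.vresVer A (G.ver.id A) hg)
      (G.hdbl.dom (G.vind.res (G.hor.id A) a h)) := by
    rw [eg, hdom_eq, c1]; exact G.hind.le_refl _
  have l2 : G.vind.objLe (G.hresHor A (G.hor.id A) hf)
      (G.vdbl.dom (G.hind.res (G.ver.id A) a h')) := by
    rw [ef, vdom_eq, c2]; exact G.vind.le_refl _
  have := G.res_res a (G.hor.id A) (G.ver.id A) A
    (by rw [G.hor.dom_id, G.ver.dom_id, objMeetH_self]) h h' hg hf l1 l2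
  rw [← G.hind.res_unique _ _ l1 _ (G.hind.le_refl _) (by rw [eg, hdom_eq, c1]),
    ← G.vind.res_unique _ _ l2 _ (G.vind.le_refl _) (by rw [ef, vdom_eq, c2])] at this
  exact this

theorem vle_of_hle {a b : G.Dbl} (h : G.hind.le a b) : G.vind.le a b := by
  have h1 : G.hind.objLe (G.ver.id (G.corner a)) (G.hdbl.dom b) := by
    rw [← hdom_eq]; exact G.hind.id_le h
  have h2 : G.vind.objLe (G.hor.id (G.corner a)) (G.vdbl.dom b) := by
    rw [hdom_eq, hle_iff] at h1
    rw [vdom_eq, vle_iff, ← objMeetH_eq_objMeetV, h1]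
  rw [G.hind.res_unique _ _ h1 a h (G.hdom_eq a), ← G.vres_eq_hres _ _ h2]
  exact G.vind.res_le _ _ _

theorem hle_of_vle {a b : G.Dbl} (h : G.vind.le a b) : G.hind.le a b := by
  have h2 : G.vind.objLe (G.hor.id (G.corner a)) (G.vdbl.dom b) := by
    rw [← vdom_eq]; exact G.vind.id_le h
  have h1 : G.hind.objLe (G.ver.id (G.corner a)) (G.hdbl.dom b) := by
    rw [vdom_eq, vle_iff] at h2
    rw [hdom_eq, hle_iff, objMeetH_eq_objMeetV, h2]
  rw [G.vind.res_unique _ _ h2 a h (G.vdom_eq a), G.vres_eq_hres _ _ _ h1]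
  exact G.hind.res_le _ _ _

theorem toTotal_of_le {A : G.Obj} {a b : G.Dbl} (h : G.hind.le a b) (ha : G.corner a = A)
    (hA : A ≤ G.corner b) : G.toTotal a = ⟨A, G.toPresheaf.res hA (CellsAt.mk b rfl)⟩ := by
  subst ha
  exact congrArg (Sigma.mk (G.corner a)) (CellsAt.eq_restrict hA (CellsAt.mk b rfl)
    (CellsAt.mk a rfl) h)

theorem toTotal_comp {A : G.Obj} {a b : G.Dbl} {x y : G.CellsAt A} (ha : G.toTotal a = ⟨A, x⟩)
    (hb : G.toTotal b = ⟨A, y⟩) (h) : G.toTotal (G.hdbl.comp a b h) = ⟨A, x + y⟩ := by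
  rw [← toTotal_val] at ha hb
  have ha := G.toTotal_injective ha
  have hb := G.toTotal_injective hb
  subst ha hb
  exact G.toTotal_val (x + y)

theorem toTotal_vcomp {A : G.Obj} {a b : G.Dbl} {x y : G.CellsAt A} (ha : G.toTotal a = ⟨A, x⟩)
    (hb : G.toTotal b = ⟨A, y⟩) (h) : G.toTotal (G.vdbl.comp a b h) = ⟨A, x + y⟩ := by
  rw [← toTotal_val] at ha hb
  have ha := G.toTotal_injective ha
  have hb := G.toTotal_injective hb
  subst ha hb
  rw [← CellsAt.vadd_eq_add]
  exact G.toTotal_val (CellsAt.vadd x y)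

theorem toTotal_hprod (a b : G.Dbl) :
    G.toTotal (G.hind.prod a b) = G.toPresheaf.mul (G.toTotal a) (G.toTotal b) := by
  have e : G.hind.meet (G.hdbl.cod a) (G.hdbl.dom b) = G.ver.id (G.corner a ⊓ G.corner b) := by
    rw [hcod_eq, hdom_eq, meetH_id]; rfl
  refine G.toTotal_comp (G.toTotal_of_le (G.hind.cores_le _ _ _) ?_ inf_le_left)
    (G.toTotal_of_le (G.hind.res_le _ _ _) ?_ inf_le_right) _
  · have := G.hind.cod_cores a _ (G.hind.meet_le_left (G.hdbl.cod a) (G.hdbl.dom b))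
    rw [hcod_eq] at this
    have := congrArg G.ver.dom (this.trans e)
    rwa [G.ver.dom_id, G.ver.dom_id] at this
  · exact G.corner_of_hdom ((G.hind.dom_res _ _ _).trans e)

theorem toTotal_vprod (a b : G.Dbl) :
    G.toTotal (G.vind.prod a b) = G.toPresheaf.mul (G.toTotal a) (G.toTotal b) := by
  have e : G.vind.meet (G.vdbl.cod a) (G.vdbl.dom b) = G.hor.id (G.corner a ⊓ G.corner b) := by
    rw [vcod_eq, vdom_eq, meetV_id, ← objMeetH_eq_objMeetV]; rfl
  refine G.toTotal_vcomp (G.toTotal_of_le (G.hle_of_vle (G.vind.cores_le _ _ _)) ?_ inf_le_left)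
    (G.toTotal_of_le (G.hle_of_vle (G.vind.res_le _ _ _)) ?_ inf_le_right) _
  · have := G.vind.cod_cores a _ (G.vind.meet_le_left (G.vdbl.cod a) (G.vdbl.dom b))
    rw [vcod_eq] at this
    have := congrArg G.hor.dom (this.trans e)
    rwa [G.hor.dom_id, G.hor.dom_id] at this
  · exact G.corner_of_vdom ((G.vind.dom_res _ _ _).trans e)

theorem vprod_eq_hprod (a b : G.Dbl) : G.vind.prod a b = G.hind.prod a b :=
  G.toTotal_injective (by rw [toTotal_hprod, toTotal_vprod])

theorem hprod_comm (a b : G.Dbl) : G.hind.prod a b = G.hind.prod b a :=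
  G.toTotal_injective (by rw [toTotal_hprod, toTotal_hprod, AbMeetSLatt.mul_comm])

theorem hprod_assoc (a b c : G.Dbl) :
    G.hind.prod (G.hind.prod a b) c = G.hind.prod a (G.hind.prod b c) :=
  G.toTotal_injective (by simp only [toTotal_hprod, AbMeetSLatt.mul_assoc])

theorem hprod_inverse : IsInverseOp G.hind.prod := by
  refine isInverseOp_of_comm G.hprod_assoc G.hprod_comm fun a => ?_
  have e := G.toTotal_val (-(CellsAt.mk a rfl : G.CellsAt (G.corner a)))
  refine ⟨(-(CellsAt.mk a rfl : G.CellsAt (G.corner a))).1, G.toTotal_injective ?_,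
    G.toTotal_injective ?_⟩
  · rw [toTotal_hprod, toTotal_hprod, e]
    exact AbMeetSLatt.mul_inv _ (G.toTotal a)
  · rw [toTotal_hprod, toTotal_hprod, e]
    exact AbMeetSLatt.inv_mul _ (G.toTotal a)

/-- The double inverse semigroup of double cells of a double inductive groupoid. -/
def toDoubleInverseSemigroup : DoubleInverseSemigroup.{u} where
  S := G.Dbl
  h := G.hind.prod
  v := G.vind.prod
  h_inverse := G.hprod_inverse
  v_inverse := by
    have : G.vind.prod = G.hind.prod := by funext a b; exact G.vprod_eq_hprod a b
    rw [this]; exact G.hprod_inverse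
  interchange a b c d := by
    have : Std.Associative G.hind.prod := ⟨G.hprod_assoc⟩
    have : Std.Commutative G.hind.prod := ⟨G.hprod_comm⟩
    simp only [vprod_eq_hprod]
    ac_rfl

end DoubleInductiveGroupoid

/-- The functor from double inductive groupoids to double inverse semigroups. -/
def digToDis : DoubleInductiveGroupoid.{u} ⥤ DoubleInverseSemigroup.{u} where
  obj G := G.toDoubleInverseSemigroup
  map {G G'} F := ⟨F.onDbl, G.hind.map_prod G'.hind F.hdbl F.hle F.hmeet,
    G.vind.map_prod G'.vind F.vdbl F.vle F.vmeet⟩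

/-! ### The two operations of a double inverse semigroup are commutative and coincide

This is what makes the double inductive groupoid of a double inverse semigroup well defined. In this
part the two operations are written `*` and `+`. -/

/-- Two inverse semigroup operations satisfying the middle-four interchange law. -/
structure InterchangingOps (S : Type u) [Semigroup S] [AddSemigroup S] : Prop where
  inv : ∀ a : S, ∃! b, a * b * a = a ∧ b * a * b = b
  addInv : ∀ a : S, ∃! b, a + b + a = a ∧ b + a + b = b
  inter : ∀ a b c d : S, (a * b) + (c * d) = (a + c) * (b + d)

theorem idem_comm {S : Type u} [Semigroup S] (H : ∀ a : S, ∃! b, a * b * a = a ∧ b * a * b = b)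
    {e f : S} (he : e * e = e) (hf : f * f = f) : e * f = f * e := by
  -- a product of idempotents is idempotent
  have key : ∀ e f : S, e * e = e → f * f = f → e * f * (e * f) = e * f := by
    intro e f he hf
    obtain ⟨x, ⟨h1, h2⟩, hu⟩ := H (e * f)
    have hx : f * x * e = x := by
      refine hu _ ⟨?_, ?_⟩
      · calc e * f * (f * x * e) * (e * f) = e * (f * f) * x * (e * e) * f := by
              simp only [mul_assoc]
          _ = e * f * x * (e * f) := by rw [he, hf]; simp only [mul_assoc]
          _ = e * f := h1
      · calc f * x * e * (e * f) * (f * x * e) = f * x * (e * e) * (f * f) * x * e := by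
              simp only [mul_assoc]
          _ = f * (x * (e * f) * x) * e := by rw [he, hf]; simp only [mul_assoc]
          _ = f * x * e := by rw [h2]
    have hxx : x * x = x := by
      calc x * x = f * x * e * (f * x * e) := by rw [hx]
        _ = f * (x * (e * f) * x) * e := by simp only [mul_assoc]
        _ = x := by rw [h2, hx]
    have : e * f = x := (H x).unique ⟨h2, h1⟩ ⟨by rw [hxx, hxx], by rw [hxx, hxx]⟩
    rw [this, hxx]
  have h1 := key e f he hf
  have h2 := key f e hf he
  refine ((H (e * f)).unique ⟨by rw [h1, h1], by rw [h1, h1]⟩ ⟨?_, ?_⟩)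
  · calc e * f * (f * e) * (e * f) = e * (f * f) * (e * e) * f := by simp only [mul_assoc]
      _ = e * f * (e * f) := by rw [he, hf]; simp only [mul_assoc]
      _ = e * f := h1
  · calc f * e * (e * f) * (f * e) = f * (e * e) * (f * f) * e := by simp only [mul_assoc]
      _ = f * e * (f * e) := by rw [he, hf]; simp only [mul_assoc]
      _ = f * e := h2

namespace InterchangingOps

theorem add_idem_comm {S : Type u} [AddSemigroup S]
    (H : ∀ a : S, ∃! b, a + b + a = a ∧ b + a + b = b)
    {e f : S} (he : e + e = e) (hf : f + f = f) : e + f = f + e :=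
  letI : Semigroup S := { mul := fun a b => a + b, mul_assoc := fun a b c => add_assoc a b c }
  idem_comm (S := S) H he hf

theorem swap {S : Type u} [i : Semigroup S] [j : AddSemigroup S] (D : InterchangingOps S) :
    @InterchangingOps S { mul := fun a b => a + b, mul_assoc := fun a b c => add_assoc a b c }
      { add := fun a b => a * b, add_assoc := fun a b c => mul_assoc a b c } :=
  @InterchangingOps.mk S { mul := fun a b => a + b, mul_assoc := fun a b c => add_assoc a b c }
      { add := fun a b => a * b, add_assoc := fun a b c => mul_assoc a b c }
    D.addInv D.inv (fun a b c d => (D.inter a c b d).symm)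

variable {S : Type u} [Semigroup S] [AddSemigroup S]

theorem mul_eq_add_of_idem (D : InterchangingOps S) {p q : S} (hp : p * p = p) (hp' : p + p = p) (hq : q * q = q)
    (hq' : q + q = q) : p * q = p + q := by
  have hpq : p * q + p * q = p * q := by rw [D.inter, hp', hq']
  have hpq' : (p + q) * (p + q) = p + q := by rw [← D.inter, hp, hq]
  calc p * q = p * q + q * p := by rw [idem_comm D.inv hq hp, hpq]
    _ = (p + q) * (q + p) := D.inter _ _ _ _
    _ = p + q := by rw [add_idem_comm D.addInv hq' hp', hpq']

/-- The additive inverse of a multiplicative idempotent is a multiplicative idempotent. -/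
theorem idem_of_addInv (D : InterchangingOps S) {x y : S} (hx : x * x = x) (h1 : x + y + x = x) (h2 : y + x + y = y) :
    y * y = y := by
  refine (D.addInv x).unique ⟨?_, ?_⟩ ⟨h1, h2⟩
  · calc x + y * y + x = x * x + y * y + x * x := by rw [hx]
      _ = (x + y + x) * (x + y + x) := by rw [D.inter, D.inter]
      _ = x := by rw [h1, hx]
  · calc y * y + x + y * y = y * y + x * x + y * y := by rw [hx]
      _ = (y + x + y) * (y + x + y) := by rw [D.inter, D.inter]
      _ = y * y := by rw [h2]

theorem idem_below (D : InterchangingOps S) {x y : S} (hx : x * x = x) (hy : y * y = y) (h1 : x + y + x = x)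
    (h2 : y + x + y = y) : (y + x) * (x + y) = x + y := by
  obtain ⟨d, hd⟩ : ∃ d, d = x + y := ⟨_, rfl⟩
  obtain ⟨r, hr⟩ : ∃ r, r = y + x := ⟨_, rfl⟩
  have dd : d * d = d := by rw [hd, ← D.inter, hx, hy]
  have dd' : d + d = d := by rw [hd, ← add_assoc, h1]
  have rr : r * r = r := by rw [hr, ← D.inter, hx, hy]
  have rr' : r + r = r := by rw [hr, ← add_assoc, h2]
  obtain ⟨c, hc⟩ : ∃ c, c = r * d := ⟨_, rfl⟩
  have cc : c * c = c := by
    rw [hc, mul_assoc, ← mul_assoc d, idem_comm D.inv dd rr, mul_assoc, dd, ← mul_assoc, rr]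
  have cc' : c + c = c := by rw [hc, D.inter, rr', dd']
  have cd : c * d = c := by rw [hc, mul_assoc, dd]
  have cd' : c + d = c := by rw [← D.mul_eq_add_of_idem cc cc' dd dd', cd]
  have dc' : d + c = c := by rw [add_idem_comm D.addInv dd' cc', cd']
  obtain ⟨f, hf⟩ : ∃ f, f = x * d := ⟨_, rfl⟩
  obtain ⟨g, hg⟩ : ∃ g, g = y * d := ⟨_, rfl⟩
  have fg : f + g = d := by rw [hf, hg, D.inter, dd', ← hd, dd]
  have gf : g + f = c := by rw [hf, hg, D.inter, dd', ← hr, hc]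
  have df : d * f = f := by rw [hf, idem_comm D.inv hx dd, ← mul_assoc, dd]
  have dg : d * g = g := by rw [hg, idem_comm D.inv hy dd, ← mul_assoc, dd]
  have df' : d + f = f := by
    have : d + x = x := by rw [hd, h1]
    calc d + f = d * d + x * d := by rw [dd, hf]
      _ = f := by rw [D.inter, this, dd', hf]
  have cf : c + f = c * f := by
    calc c + f = c * d + d * f := by rw [cd, df]
      _ = c * f := by rw [D.inter, cd', df']
  have gcf : g + (c + f) = c := by
    calc g + (c + f) = d * g + c * f := by rw [dg, cf]
      _ = c := by rw [D.inter, dc', gf, cc]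
  have e1 : f + (g + (c + f)) + g = c := by
    calc f + (g + (c + f)) + g = (f + g) + c + (f + g) := by simp only [add_assoc]
      _ = c := by rw [fg, dc', cd']
  have e2 : f + (g + (c + f)) + g = d := by
    calc f + (g + (c + f)) + g = f + c + g := by rw [gcf]
      _ = (f + g) + (f + g) := by rw [← gf]; simp only [add_assoc]
      _ = d := by rw [fg, dd']
  rw [← hd, ← hr, ← hc, ← e1, e2]

theorem add_self_of_idem (D : InterchangingOps S) {x : S} (hx : x * x = x) : x + x = x := by
  obtain ⟨y, ⟨h1, h2⟩, -⟩ := D.addInv x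
  have hy := D.idem_of_addInv hx h1 h2
  have l1 := D.idem_below hx hy h1 h2
  have l2 := D.idem_below hy hx h2 h1
  obtain ⟨e, he⟩ : ∃ e, e = x + y := ⟨_, rfl⟩
  have dd : e * e = e := by rw [he, ← D.inter, hx, hy]
  have ee : e + e = e := by rw [he, ← add_assoc, h1]
  have rr : (y + x) * (y + x) = y + x := by rw [← D.inter, hx, hy]
  have hr : y + x = e := by
    rw [← he] at l1 l2
    rw [← l2, idem_comm D.inv dd rr, l1]
  have key : ∀ x y : S, x * x = x → y * y = y → y + x = e → e + x = x →
      x * e = e ∧ y * e + x = x * e := by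
    intro x y hx hy h1 h2
    have kh : y * e + x * e = e := by rw [D.inter, h1, ee, dd]
    have kx : y * e + x = x * e := by
      calc y * e + x = y * e + x * x := by rw [hx]
        _ = x * e := by rw [D.inter, h1, h2, idem_comm D.inv hx dd]
    refine ⟨?_, kx⟩
    have ye : y * e * (y * e) = y * e := by
      rw [mul_assoc, ← mul_assoc e, idem_comm D.inv dd hy, mul_assoc, dd, ← mul_assoc, hy]
    have xe : x * e * x = x * e := by
      rw [mul_assoc, idem_comm D.inv dd hx, ← mul_assoc, hx]
    have := D.inter (y * e) (y * e) (x * e) x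
    rw [ye, xe, kh, kx, idem_comm D.inv hx dd, ← mul_assoc, dd] at this
    rw [idem_comm D.inv hx dd, ← this]
  have ex : e + x = x := by rw [he, h1]
  have ey : e + y = y := by rw [← hr, h2]
  obtain ⟨k1, k2⟩ := key x y hx hy hr ex
  obtain ⟨k3, -⟩ := key y x hy hx he.symm ey
  rw [k3, ex, k1] at k2
  rw [k2, ee]

theorem mul_self_of_idem (D : InterchangingOps S) {x : S} (hx : x + x = x) : x * x = x :=
  @add_self_of_idem S { mul := fun a b => a + b, mul_assoc := fun a b c => add_assoc a b c }
    { add := fun a b => a * b, add_assoc := fun a b c => mul_assoc a b c } D.swap x hx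

/-- Every element lies in a common subgroup of the two semigroups. -/
theorem exists_unit (D : InterchangingOps S) (a : S) : ∃ e i j : S, e * e = e ∧ e + e = e ∧ a * i = e ∧ i * a = e ∧
    a + j = e ∧ j + a = e ∧ a * i * a = a ∧ i * a * i = i ∧ a + j + a = a ∧ j + a + j = j := by
  obtain ⟨i, ⟨i1, i2⟩, -⟩ := D.inv a
  obtain ⟨j, ⟨j1, j2⟩, -⟩ := D.addInv a
  obtain ⟨k, ⟨k1, k2⟩, -⟩ := D.addInv i
  -- `k` is also the multiplicative inverse of `j`
  have jk : j * k * j = j := by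
    refine (D.addInv a).unique ⟨?_, ?_⟩ ⟨j1, j2⟩
    · calc a + j * k * j + a = a * i * a + j * k * j + a * i * a := by rw [i1]
        _ = (a + j + a) * (i + k + i) * (a + j + a) := by simp only [D.inter]
        _ = a := by rw [j1, k1, i1]
    · calc j * k * j + a + j * k * j = j * k * j + a * i * a + j * k * j := by rw [i1]
        _ = (j + a + j) * (k + i + k) * (j + a + j) := by simp only [D.inter]
        _ = j * k * j := by rw [j2, k2]
  have kj : k * j * k = k := by
    refine (D.addInv i).unique ⟨?_, ?_⟩ ⟨k1, k2⟩
    · calc i + k * j * k + i = i * a * i + k * j * k + i * a * i := by rw [i2]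
        _ = (i + k + i) * (a + j + a) * (i + k + i) := by simp only [D.inter]
        _ = i := by rw [j1, k1, i2]
    · calc k * j * k + i + k * j * k = k * j * k + i * a * i + k * j * k := by rw [i2]
        _ = (k + i + k) * (j + a + j) * (k + i + k) := by simp only [D.inter]
        _ = k * j * k := by rw [j2, k2]
  obtain ⟨e, he⟩ : ∃ e, e = a + j := ⟨_, rfl⟩
  have ee : e + e = e := by rw [he, ← add_assoc, j1]
  have ee' : e * e = e := D.mul_self_of_idem ee
  have uu : j + a + (j + a) = j + a := by rw [← add_assoc, j2]
  have uu' : (j + a) * (j + a) = j + a := D.mul_self_of_idem uu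
  have pp : a * i * (a * i) = a * i := by rw [← mul_assoc, i1]
  have pp' : a * i + a * i = a * i := D.add_self_of_idem pp
  have qq : i * a * (i * a) = i * a := by rw [← mul_assoc, i2]
  have qq' : i * a + i * a = i * a := D.add_self_of_idem qq
  -- inverses of the idempotents, computed in two ways
  have s1 : j * k = a * i := by
    refine (D.addInv (a * i)).unique ⟨?_, ?_⟩ ⟨by rw [pp', pp'], by rw [pp', pp']⟩
    · rw [D.inter, D.inter, j1, k1]
    · rw [D.inter, D.inter, j2, k2]
  have s2 : k * j = i * a := by
    refine (D.addInv (i * a)).unique ⟨?_, ?_⟩ ⟨by rw [qq', qq'], by rw [qq', qq']⟩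
    · rw [D.inter, D.inter, j1, k1]
    · rw [D.inter, D.inter, j2, k2]
  have s3 : i + k = e := by
    refine (D.inv e).unique ⟨?_, ?_⟩ ⟨by rw [ee', ee'], by rw [ee', ee']⟩
    · rw [he, ← D.inter, ← D.inter, i1, jk]
    · rw [he, ← D.inter, ← D.inter, i2, kj]
  have s4 : k + i = j + a := by
    refine (D.inv (j + a)).unique ⟨?_, ?_⟩ ⟨by rw [uu', uu'], by rw [uu', uu']⟩
    · rw [← D.inter, ← D.inter, i1, jk]
    · rw [← D.inter, ← D.inter, i2, kj]
  have t1 : a * i = e := by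
    calc a * i = a * i + j * k := by rw [s1, pp']
      _ = e := by rw [D.inter, s3, ← he, ee']
  have t2 : i * a = e := by
    calc i * a = i * a + k * j := by rw [s2, qq']
      _ = e := by rw [D.inter, s3, ← he, ee']
  have t3 : j + a = e := by
    calc j + a = (j + a) * (k + i) := by rw [s4, uu']
      _ = j * k + a * i := (D.inter _ _ _ _).symm
      _ = e := by rw [s1, pp', t1]
  exact ⟨e, i, j, ee', ee, t1, t2, he.symm, t3, i1, i2, j1, j2⟩

/-- Restricting an element to an idempotent below its unit. -/
theorem restrict_unit (D : InterchangingOps S) {a e i g : S} (h1 : a * i = e)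
    (h3 : a * i * a = a) (h4 : i * a * i = i) (hg : g * g = g) (hge : g * e = g) :
    g * a = a * g ∧ (g * a) + g = g * a ∧ g + (g * a) = g * a := by
  have ee : e * e = e := by rw [← h1, ← mul_assoc, h3]
  have heg : e * g = g := by rw [idem_comm D.inv ee hg, hge]
  have ea : e * a = a := by rw [← h1, h3]
  have ie : i * e = i := by rw [← h1, ← mul_assoc, h4]
  -- the inverse of `g * a` is `i * g`
  have r1 : g * a * (i * g) = g := by
    calc g * a * (i * g) = g * (a * i) * g := by simp only [mul_assoc]
      _ = g := by rw [h1, hge, hg]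
  have v1 : g * a * (i * g) * (g * a) = g * a := by rw [r1, ← mul_assoc, hg]
  have v2 : i * g * (g * a) * (i * g) = i * g := by
    rw [mul_assoc, r1, mul_assoc, hg]
  obtain ⟨u, k, j, -, -, u1, u2, u3, u4, k1, k2, j1, -⟩ := D.exists_unit (g * a)
  have hk : k = i * g := (D.inv (g * a)).unique ⟨k1, k2⟩ ⟨v1, v2⟩
  subst hk
  have hu : u = g := u1.symm.trans r1
  subst hu
  have s1 : i * u * a = u := by
    calc i * u * a = i * (u * u) * a := by rw [hg]
      _ = i * u * (u * a) := by simp only [mul_assoc]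
      _ = u := u2
  refine ⟨?_, ?_, ?_⟩
  · calc u * a = e * u * a := by rw [heg]
      _ = a * (i * u * a) := by rw [← h1]; simp only [mul_assoc]
      _ = a * u := by rw [s1]
  · calc u * a + u = u * a + (j + u * a) := by rw [u4]
      _ = u * a := by rw [← add_assoc, j1]
  · calc u + u * a = (u * a + j) + u * a := by rw [u3]
      _ = u * a := j1

/-- The two operations coincide and are commutative. -/
theorem mul_eq_add_and_comm (D : InterchangingOps S) (a b : S) :
    a * b = a + b ∧ a * b = b * a := by
  obtain ⟨e, i, j, ee, ee', a1, a2, a3, a4, a5, a6, a7, a8⟩ := D.exists_unit a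
  obtain ⟨f, k, l, ff, ff', b1, b2, b3, b4, b5, b6, b7, b8⟩ := D.exists_unit b
  obtain ⟨g, hg⟩ : ∃ g, g = e * f := ⟨_, rfl⟩
  have hg' : g = e + f := by rw [hg, D.mul_eq_add_of_idem ee ee' ff ff']
  have fe : f * e = g := by rw [hg, idem_comm D.inv ff ee]
  have fe' : f + e = g := by rw [hg', add_idem_comm D.addInv ff' ee']
  have ge : g * e = g := by rw [← fe, mul_assoc, ee]
  have gf : g * f = g := by rw [hg, mul_assoc, ff]
  have gg : g * g = g := by
    calc g * g = g * e * f := by rw [mul_assoc, ← hg]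
      _ = g := by rw [ge, gf]
  have ge' : g + e = g := by rw [← fe', add_assoc, ee']
  have gf' : g + f = g := by rw [hg', add_assoc, ff']
  have gg' : g + g = g := D.add_self_of_idem gg
  -- restriction to `g` is the same for both operations
  have res : ∀ x p i j : S, x * i = p → i * x = p → x + j = p → j + x = p →
      x * i * x = x → i * x * i = i → x + j + x = x → j + x + j = j → g * p = g → g + p = g →
      g * x = x * g ∧ g + x = x + g ∧ g * x = g + x ∧ g * x + g = g * x ∧ g + g * x = g * x := by
    intro x p i j h1 h2 h3 h4 h5 h6 h7 h8 h9 h10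
    obtain ⟨r1, r2, r3⟩ := D.restrict_unit h1 h5 h6 gg h9
    obtain ⟨q1, q2, q3⟩ := @restrict_unit S
      { mul := fun a b => a + b, mul_assoc := fun a b c => add_assoc a b c }
      { add := fun a b => a * b, add_assoc := fun a b c => mul_assoc a b c } D.swap
      x p j g h3 h7 h8 gg' h10
    change g + x = x + g at q1
    change g * (g + x) = g + x at q3
    refine ⟨r1, q1, ?_, r2, r3⟩
    calc g * x = g * g + g * x := by rw [gg, r3]
      _ = g + x := by rw [D.inter, gg', q3]
  obtain ⟨c1, c2, c3, c4, c5⟩ := res a e i j a1 a2 a3 a4 a5 a6 a7 a8 ge ge'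
  obtain ⟨d1, d2, d3, d4, d5⟩ := res b f k l b1 b2 b3 b4 b5 b6 b7 b8 gf gf'
  have ae : a * e = a := by rw [← a2, ← mul_assoc, a5]
  have fb : f * b = b := by rw [← b1, b5]
  have ae' : a + e = a := by rw [← a4, ← add_assoc, a7]
  have fb' : f + b = b := by rw [← b3, b7]
  have ga : g * (g * a) = g * a := by rw [← mul_assoc, gg]
  have gb : g * (g * b) = g * b := by rw [← mul_assoc, gg]
  have ga2 : g * a * g = g * a := by rw [c1, mul_assoc, gg]
  have gb2 : g * b * g = g * b := by rw [d1, mul_assoc, gg]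
  have m1 : a * b = (g * a) * (g * b) := by
    calc a * b = a * e * (f * b) := by rw [ae, fb]
      _ = a * (e * f) * b := by simp only [mul_assoc]
      _ = a * g * (g * b) := by rw [← hg, mul_assoc a g (g * b), gb, mul_assoc]
      _ = (g * a) * (g * b) := by rw [c1]
  have m2 : a + b = (g * a) + (g * b) := by
    calc a + b = a + e + (f + b) := by rw [ae', fb']
      _ = a + (e + f) + b := by simp only [add_assoc]
      _ = a + g + (g + b) := by rw [← hg', add_assoc a g (g + b), ← add_assoc g g b, gg', add_assoc]
      _ = (g * a) + (g * b) := by rw [← c2, c3, d3]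
  have m3 : (g * a) + (g * b) = (g * a) * (g * b) := by
    calc (g * a) + (g * b) = (g * a) * g + g * (g * b) := by rw [ga2, gb]
      _ = _ := by rw [D.inter, c4, d5]
  have m4 : (g * a) + (g * b) = (g * b) * (g * a) := by
    calc (g * a) + (g * b) = g * (g * a) + (g * b) * g := by rw [ga, gb2]
      _ = _ := by rw [D.inter, d5, c4]
  have m5 : b * a = (g * b) * (g * a) := by
    have be : b * f = b := by rw [← b2, ← mul_assoc, b5]
    have ea : e * a = a := by rw [← a1, a5]
    calc b * a = b * f * (e * a) := by rw [be, ea]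
      _ = b * (f * e) * a := by simp only [mul_assoc]
      _ = b * g * (g * a) := by rw [fe, mul_assoc b g (g * a), ga, mul_assoc]
      _ = (g * b) * (g * a) := by rw [d1]
  exact ⟨by rw [m1, m2, m3], by rw [m1, m5, ← m4, m3]⟩

end InterchangingOps
/-! ### The double inductive groupoid of a double inverse semigroup -/

namespace IsInverseOp

variable {S : Type u} {m : S → S → S}

/-- The semigroup inverse. -/
noncomputable def inv (H : IsInverseOp m) (a : S) : S := (H.2 a).choose

theorem mul_inv_mul (H : IsInverseOp m) (a : S) : m (m a (H.inv a)) a = a :=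
  (H.2 a).choose_spec.1.1

theorem inv_mul_inv (H : IsInverseOp m) (a : S) : m (m (H.inv a) a) (H.inv a) = H.inv a :=
  (H.2 a).choose_spec.1.2

theorem eq_inv (H : IsInverseOp m) {a b : S} (h1 : m (m a b) a = a) (h2 : m (m b a) b = b) :
    b = H.inv a :=
  (H.2 a).unique ⟨h1, h2⟩ ⟨H.mul_inv_mul a, H.inv_mul_inv a⟩

theorem inv_idem (H : IsInverseOp m) {e : S} (he : m e e = e) : H.inv e = e :=
  (H.eq_inv (by rw [he, he]) (by rw [he, he])).symm

theorem inv_inv (H : IsInverseOp m) (a : S) : H.inv (H.inv a) = a :=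
  (H.eq_inv (H.inv_mul_inv a) (H.mul_inv_mul a)).symm

theorem dom_idem (H : IsInverseOp m) (a : S) :
    m (m a (H.inv a)) (m a (H.inv a)) = m a (H.inv a) := by
  rw [← H.1, H.mul_inv_mul]

theorem cod_idem (H : IsInverseOp m) (a : S) :
    m (m (H.inv a) a) (m (H.inv a) a) = m (H.inv a) a := by
  rw [← H.1, H.inv_mul_inv]

theorem inter_comm (H : IsInverseOp m) (comm : ∀ a b, m a b = m b a) (a b c d : S) :
    m (m a b) (m c d) = m (m a c) (m b d) := by
  have : Std.Associative m := ⟨H.1⟩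
  have : Std.Commutative m := ⟨comm⟩
  ac_rfl

theorem inv_mul (H : IsInverseOp m) (comm : ∀ a b, m a b = m b a) (a b : S) :
    H.inv (m a b) = m (H.inv a) (H.inv b) := by
  refine (H.eq_inv ?_ ?_).symm
  · rw [H.inter_comm comm a b, H.inter_comm comm (m a _), H.mul_inv_mul, H.mul_inv_mul]
  · rw [H.inter_comm comm (H.inv a) (H.inv b) a b, H.inter_comm comm (m (H.inv a) a),
      H.inv_mul_inv, H.inv_mul_inv]

theorem idem_mul (H : IsInverseOp m) (comm : ∀ a b, m a b = m b a) {e f : S} (he : m e e = e)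
    (hf : m f f = f) : m (m e f) (m e f) = m e f := by
  rw [H.inter_comm comm, he, hf]

theorem dom_self (H : IsInverseOp m) {e : S} (he : m e e = e) : m e (H.inv e) = e := by
  rw [H.inv_idem he, he]

theorem dom_mul (H : IsInverseOp m) (comm : ∀ a b, m a b = m b a) (a b : S) :
    m (m a b) (H.inv (m a b)) = m (m a (H.inv a)) (m b (H.inv b)) := by
  rw [H.inv_mul comm, H.inter_comm comm]

theorem cod_mul (H : IsInverseOp m) (comm : ∀ a b, m a b = m b a) (a b : S) :
    m (H.inv (m a b)) (m a b) = m (m (H.inv a) a) (m (H.inv b) b) := by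
  rw [H.inv_mul comm, H.inter_comm comm]

theorem dom_mul_dom_mul (H : IsInverseOp m) (comm : ∀ a b, m a b = m b a) {x f g i : S}
    (hx : m x x = x) (hf : m f f = f) (hg : m g g = g) (hi : m i i = i) :
    m (m (m (m x f) (H.inv (m x f))) (m (m g i) (H.inv (m g i))))
        (H.inv (m (m (m x f) (H.inv (m x f))) (m (m g i) (H.inv (m g i))))) =
      m (m (m (m x g) (H.inv (m x g))) (m (m f i) (H.inv (m f i))))
        (H.inv (m (m (m x g) (H.inv (m x g))) (m (m f i) (H.inv (m f i))))) := by
  rw [H.dom_self (H.idem_mul comm hx hf), H.dom_self (H.idem_mul comm hg hi),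
    H.dom_self (H.idem_mul comm hx hg), H.dom_self (H.idem_mul comm hf hi),
    H.inter_comm comm x f g i]

/-- The groupoid of an inverse semigroup, whose operation is known to be commutative: objects are
the idempotents, arrows are the elements, `a` goes from `a a⁻¹` to `a⁻¹ a`, and composition is
multiplication. -/
noncomputable def gpd (H : IsInverseOp m) (comm : ∀ a b, m a b = m b a) :
    GroupoidOn { e : S // m e e = e } S where
  dom a := ⟨m a (H.inv a), H.dom_idem a⟩
  cod a := ⟨m (H.inv a) a, H.cod_idem a⟩
  id e := e.1
  comp a b _ := m a b
  inv a := H.inv a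
  dom_id e := Subtype.ext (by change m e.1 (H.inv e.1) = e.1; rw [H.inv_idem e.2, e.2])
  cod_id e := Subtype.ext (by change m (H.inv e.1) e.1 = e.1; rw [H.inv_idem e.2, e.2])
  dom_comp a b h := Subtype.ext (by
    have h : m (H.inv a) a = m b (H.inv b) := congrArg Subtype.val h
    change m (m a b) (H.inv (m a b)) = m a (H.inv a)
    rw [H.inv_mul comm, H.inter_comm comm, ← h, comm (H.inv a), H.dom_idem])
  cod_comp a b h := Subtype.ext (by
    have h : m (H.inv a) a = m b (H.inv b) := congrArg Subtype.val h
    change m (H.inv (m a b)) (m a b) = m (H.inv b) b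
    rw [H.inv_mul comm, H.inter_comm comm, h, comm (H.inv b), H.dom_idem])
  id_comp a h := H.mul_inv_mul a
  comp_id a h := by rw [← H.1, H.mul_inv_mul]
  assoc a b c _ _ _ _ := H.1 a b c
  dom_inv a := Subtype.ext (by
    change m (H.inv a) (H.inv (H.inv a)) = m (H.inv a) a; rw [H.inv_inv])
  cod_inv a := Subtype.ext (by
    change m (H.inv (H.inv a)) (H.inv a) = m a (H.inv a); rw [H.inv_inv])
  comp_inv a h := rfl
  inv_comp a h := rfl

/-- The inductive structure of the groupoid of an inverse semigroup: `a ≤ b` if `a = e b` for an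
idempotent `e`, and (co)restrictions and meets are products. -/
noncomputable def ind (H : IsInverseOp m) (comm : ∀ a b, m a b = m b a) :
    InductiveStr (H.gpd comm) where
  le a b := ∃ e, m e e = e ∧ a = m e b
  le_refl a := ⟨m a (H.inv a), H.dom_idem a, (H.mul_inv_mul a).symm⟩
  le_trans a b c := by
    rintro ⟨e, he, rfl⟩ ⟨f, hf, rfl⟩
    exact ⟨m e f, H.idem_mul comm he hf, (H.1 _ _ _).symm⟩
  le_antisymm a b := by
    rintro ⟨e, he, h1⟩ ⟨f, hf, h2⟩
    have h3 : m f b = b := by rw [h2, ← H.1, hf]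
    calc a = m e b := h1
      _ = m e (m f a) := by rw [← h2]
      _ = m f (m e a) := by rw [← H.1, comm e f, H.1]
      _ = m f (m e b) := by rw [h1, ← H.1 e, he]
      _ = b := by rw [← h1, ← h2]
  inv_le a b := by
    rintro ⟨e, he, rfl⟩
    exact ⟨e, he, by change H.inv _ = m e (H.inv b); rw [H.inv_mul comm, H.inv_idem he]⟩
  comp_le x y w z _ _ := by
    rintro ⟨e, he, rfl⟩ ⟨f, hf, rfl⟩
    exact ⟨m e f, H.idem_mul comm he hf, H.inter_comm comm _ _ _ _⟩
  res e x _ := m e.1 x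
  res_le e x _ := ⟨e.1, e.2, rfl⟩
  dom_res e x h := Subtype.ext (by
    obtain ⟨f, hf, h⟩ := h
    have h : e.1 = m f (m x (H.inv x)) := h
    change m (m e.1 x) (H.inv (m e.1 x)) = e.1
    rw [H.inv_mul comm, H.inter_comm comm, H.inv_idem e.2, e.2, h, H.1, H.dom_idem])
  res_unique e x h y := by
    rintro ⟨f, hf, rfl⟩ rfl
    change m f x = m (m (m f x) (H.inv (m f x))) x
    rw [H.inv_mul comm, H.inter_comm comm, H.inv_idem hf, hf, H.1, H.mul_inv_mul]
  cores x e _ := m x e.1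
  cores_le x e _ := ⟨e.1, e.2, comm _ _⟩
  cod_cores x e h := Subtype.ext (by
    obtain ⟨f, hf, h⟩ := h
    have h : e.1 = m f (m (H.inv x) x) := h
    change m (H.inv (m x e.1)) (m x e.1) = e.1
    rw [H.inv_mul comm, H.inter_comm comm, H.inv_idem e.2, e.2, comm, h, H.1, H.cod_idem])
  cores_unique x e h y := by
    rintro ⟨f, hf, rfl⟩ rfl
    change m f x = m x (m (H.inv (m f x)) (m f x))
    rw [H.inv_mul comm, H.inter_comm comm, H.inv_idem hf, hf, ← H.1, comm x f, H.1, ← H.1 x,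
      H.mul_inv_mul]
  meet e f := ⟨m e.1 f.1, H.idem_mul comm e.2 f.2⟩
  meet_le_left e f := ⟨f.1, f.2, comm _ _⟩
  meet_le_right e f := ⟨e.1, e.2, rfl⟩
  le_meet e f g := by
    rintro ⟨a, ha, h1⟩ ⟨b, hb, h2⟩
    refine ⟨m a b, H.idem_mul comm ha hb, ?_⟩
    change g.1 = m (m a b) (m e.1 f.1)
    have h1 : g.1 = m a e.1 := h1
    have h2 : g.1 = m b f.1 := h2
    rw [H.inter_comm comm, ← h1, ← h2, g.2]

/-- For two equal commutative inverse semigroup operations `m`, `n`: the groupoid whose objects are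
the common idempotents, whose arrows are the `m`-idempotents, and whose composition is `n`. -/
noncomputable def arrowGpd {n : S → S → S} (N : IsInverseOp n)
    (comm : ∀ a b, m a b = m b a) (hmn : n = m) (P : S → Prop)
    (hP : ∀ e, P e ↔ m e e = e ∧ n e e = e) :
    GroupoidOn { e : S // P e } { e : S // m e e = e } where
  dom e := ⟨n e.1 (N.inv e.1), (hP _).2 (by subst hmn; exact ⟨N.dom_idem _, N.dom_idem _⟩)⟩
  cod e := ⟨n (N.inv e.1) e.1, (hP _).2 (by subst hmn; exact ⟨N.cod_idem _, N.cod_idem _⟩)⟩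
  id A := ⟨A.1, ((hP _).1 A.2).1⟩
  comp e f _ := ⟨n e.1 f.1, by subst hmn; exact N.idem_mul comm e.2 f.2⟩
  inv e := ⟨N.inv e.1, by subst hmn; rw [N.inv_idem e.2, e.2]⟩
  dom_id A := Subtype.ext (by
    have := ((hP _).1 A.2).2
    change n A.1 (N.inv A.1) = A.1
    rw [N.inv_idem this, this])
  cod_id A := Subtype.ext (by
    have := ((hP _).1 A.2).2
    change n (N.inv A.1) A.1 = A.1
    rw [N.inv_idem this, this])
  dom_comp a b h := by
    have h : n (N.inv a.1) a.1 = n b.1 (N.inv b.1) := congrArg Subtype.val h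
    subst hmn
    refine Subtype.ext ?_
    change n (n a.1 b.1) (N.inv (n a.1 b.1)) = n a.1 (N.inv a.1)
    rw [N.inv_mul comm, N.inter_comm comm, ← h, comm (N.inv a.1), N.dom_idem]
  cod_comp a b h := by
    have h : n (N.inv a.1) a.1 = n b.1 (N.inv b.1) := congrArg Subtype.val h
    subst hmn
    refine Subtype.ext ?_
    change n (N.inv (n a.1 b.1)) (n a.1 b.1) = n (N.inv b.1) b.1
    rw [N.inv_mul comm, N.inter_comm comm, h, comm (N.inv b.1), N.dom_idem]
  id_comp a h := Subtype.ext (N.mul_inv_mul a.1)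
  comp_id a h := Subtype.ext (by
    change n a.1 (n (N.inv a.1) a.1) = a.1
    rw [← N.1, N.mul_inv_mul])
  assoc a b c _ _ _ _ := Subtype.ext (N.1 _ _ _)
  dom_inv a := Subtype.ext (by
    change n (N.inv a.1) (N.inv (N.inv a.1)) = n (N.inv a.1) a.1; rw [N.inv_inv])
  cod_inv a := Subtype.ext (by
    change n (N.inv (N.inv a.1)) (N.inv a.1) = n a.1 (N.inv a.1); rw [N.inv_inv])
  comp_inv a h := rfl
  inv_comp a h := rfl

end IsInverseOp

namespace DoubleInverseSemigroup

theorem interchangingOps (T : DoubleInverseSemigroup.{u}) :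
    @InterchangingOps T.S { mul := T.h, mul_assoc := T.h_inverse.1 }
      { add := T.v, add_assoc := T.v_inverse.1 } :=
  @InterchangingOps.mk T.S { mul := T.h, mul_assoc := T.h_inverse.1 }
    { add := T.v, add_assoc := T.v_inverse.1 } T.h_inverse.2 T.v_inverse.2 T.interchange

theorem v_eq_h (T : DoubleInverseSemigroup.{u}) : T.v = T.h := by
  funext a b
  exact (@InterchangingOps.mul_eq_add_and_comm T.S { mul := T.h, mul_assoc := T.h_inverse.1 }
    { add := T.v, add_assoc := T.v_inverse.1 } T.interchangingOps a b).1.symm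

theorem h_comm (T : DoubleInverseSemigroup.{u}) (a b : T.S) : T.h a b = T.h b a :=
  (@InterchangingOps.mul_eq_add_and_comm T.S { mul := T.h, mul_assoc := T.h_inverse.1 }
    { add := T.v, add_assoc := T.v_inverse.1 } T.interchangingOps a b).2

theorem v_comm (T : DoubleInverseSemigroup.{u}) (a b : T.S) : T.v a b = T.v b a := by
  rw [T.v_eq_h]; exact T.h_comm a b

end DoubleInverseSemigroup

section

variable {S : Type u} {h v : S → S → S}

/-- The double groupoid of a double inverse semigroup `(S, h, v)`: vertical arrows are the
`h`-idempotents, horizontal arrows the `v`-idempotents, objects the common idempotents. -/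
noncomputable def semigroupDoubleGroupoid (H : IsInverseOp h) (V : IsInverseOp v)
    (hc : ∀ a b, h a b = h b a) (vc : ∀ a b, v a b = v b a) (e : v = h) :
    DoubleGroupoid.{u} where
  Obj := { x : S // h x x = x ∧ v x x = x }
  Ver := { x : S // h x x = x }
  Hor := { x : S // v x x = x }
  Dbl := S
  ver := IsInverseOp.arrowGpd V hc e _ (fun _ => Iff.rfl)
  hor := IsInverseOp.arrowGpd H vc e.symm _ (fun _ => and_comm)
  hdbl := H.gpd hc
  vdbl := V.gpd vc
  corner_dd a := by subst e; rfl
  corner_dc a := by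
    subst e
    exact Subtype.ext (by
      change v (v (V.inv a) a) (V.inv (v (V.inv a) a)) = v (V.inv (v a (V.inv a))) (v a (V.inv a))
      rw [V.inv_idem (V.cod_idem a), V.inv_idem (V.dom_idem a), vc (V.inv a)])
  corner_cd a := by
    subst e
    exact Subtype.ext (by
      change v (V.inv (v a (V.inv a))) (v a (V.inv a)) = v (v (V.inv a) a) (V.inv (v (V.inv a) a))
      rw [V.inv_idem (V.cod_idem a), V.inv_idem (V.dom_idem a), vc (V.inv a)])
  corner_cc a := by subst e; rfl
  hdom_vcomp a b _ _ := by
    subst e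
    exact Subtype.ext (by
      change v (v a b) (V.inv (v a b)) = v (v a (V.inv a)) (v b (V.inv b))
      rw [V.inv_mul vc, V.inter_comm vc])
  hcod_vcomp a b _ _ := by
    subst e
    exact Subtype.ext (by
      change v (V.inv (v a b)) (v a b) = v (v (V.inv a) a) (v (V.inv b) b)
      rw [V.inv_mul vc, V.inter_comm vc])
  vdom_hcomp a b _ _ := by
    subst e
    exact Subtype.ext (by
      change v (v a b) (V.inv (v a b)) = v (v a (V.inv a)) (v b (V.inv b))
      rw [V.inv_mul vc, V.inter_comm vc])
  vcod_hcomp a b _ _ := by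
    subst e
    exact Subtype.ext (by
      change v (V.inv (v a b)) (v a b) = v (v (V.inv a) a) (v (V.inv b) b)
      rw [V.inv_mul vc, V.inter_comm vc])
  vdom_hid _ := rfl
  vcod_hid _ := rfl
  hdom_vid _ := rfl
  hcod_vid _ := rfl
  hid_comp _ _ _ _ := rfl
  vid_comp _ _ _ _ := rfl
  hid_id _ := rfl
  interchange a b c d _ _ _ _ _ _ := by subst e; exact V.inter_comm vc a b c d

/-- The double inductive groupoid of a double inverse semigroup `(S, h, v)`. -/
noncomputable def semigroupDig (H : IsInverseOp h) (V : IsInverseOp v)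
    (hc : ∀ a b, h a b = h b a) (vc : ∀ a b, v a b = v b a) (e : v = h) :
    DoubleInductiveGroupoid.{u} where
  toDoubleGroupoid := semigroupDoubleGroupoid H V hc vc e
  hind := H.ind hc
  vind := V.ind vc
  hcores_vcomp a b f g _ _ _ _ _ _ := by subst e; exact V.inter_comm vc a b f.1 g.1
  vcores_hcomp a b f g _ _ _ _ _ _ := by subst e; exact V.inter_comm vc a b f.1 g.1
  hres_vcomp a b f g _ _ _ _ _ _ := by subst e; exact V.inter_comm vc f.1 g.1 a b
  vres_hcomp a b f g _ _ _ _ _ _ := by subst e; exact V.inter_comm vc f.1 g.1 a b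
  vmeet_comp x f g i _ _ _ := by
    subst e; exact Subtype.ext (V.inter_comm vc x.1 f.1 g.1 i.1)
  hmeet_comp x f g i _ _ _ := by
    subst e; exact Subtype.ext (V.inter_comm vc x.1 f.1 g.1 i.1)
  vmeet_hcores x f g i _ _ _ := by
    subst e
    refine Subtype.ext ?_
    change v (v (v x.1 f.1) (V.inv (v x.1 f.1))) (v (v g.1 i.1) (V.inv (v g.1 i.1))) =
      v (v (v x.1 g.1) (v (v f.1 i.1) (V.inv (v f.1 i.1))))
        (V.inv (v (v x.1 g.1) (v (v f.1 i.1) (V.inv (v f.1 i.1)))))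
    rw [V.dom_self (V.idem_mul vc x.2 f.2.1), V.dom_self (V.idem_mul vc g.2 i.2.1),
      V.dom_self (V.idem_mul vc f.2.1 i.2.1),
      V.dom_self (V.idem_mul vc (V.idem_mul vc x.2 g.2) (V.idem_mul vc f.2.1 i.2.1))]
    exact V.inter_comm vc _ _ _ _
  hmeet_vcores x f g i _ _ _ := by
    subst e
    refine Subtype.ext ?_
    change v (v (v x.1 f.1) (V.inv (v x.1 f.1))) (v (v g.1 i.1) (V.inv (v g.1 i.1))) =
      v (v (v x.1 g.1) (v (v f.1 i.1) (V.inv (v f.1 i.1))))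
        (V.inv (v (v x.1 g.1) (v (v f.1 i.1) (V.inv (v f.1 i.1)))))
    rw [V.dom_self (V.idem_mul vc x.2 f.2.1), V.dom_self (V.idem_mul vc g.2 i.2.1),
      V.dom_self (V.idem_mul vc f.2.1 i.2.1),
      V.dom_self (V.idem_mul vc (V.idem_mul vc x.2 g.2) (V.idem_mul vc f.2.1 i.2.1))]
    exact V.inter_comm vc _ _ _ _
  vmeet_hres x f g i _ _ _ := by
    subst e
    refine Subtype.ext ?_
    change v (v (v x.1 f.1) (V.inv (v x.1 f.1))) (v (v g.1 i.1) (V.inv (v g.1 i.1))) =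
      v (v (v (v x.1 g.1) (V.inv (v x.1 g.1))) (v f.1 i.1))
        (V.inv (v (v (v x.1 g.1) (V.inv (v x.1 g.1))) (v f.1 i.1)))
    rw [V.dom_self (V.idem_mul vc x.2.1 f.2), V.dom_self (V.idem_mul vc g.2.1 i.2),
      V.dom_self (V.idem_mul vc x.2.1 g.2.1),
      V.dom_self (V.idem_mul vc (V.idem_mul vc x.2.1 g.2.1) (V.idem_mul vc f.2 i.2))]
    exact V.inter_comm vc _ _ _ _
  hmeet_vres x f g i _ _ _ := by
    subst e
    refine Subtype.ext ?_
    change v (v (v x.1 f.1) (V.inv (v x.1 f.1))) (v (v g.1 i.1) (V.inv (v g.1 i.1))) =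
      v (v (v (v x.1 g.1) (V.inv (v x.1 g.1))) (v f.1 i.1))
        (V.inv (v (v (v x.1 g.1) (V.inv (v x.1 g.1))) (v f.1 i.1)))
    rw [V.dom_self (V.idem_mul vc x.2.1 f.2), V.dom_self (V.idem_mul vc g.2.1 i.2),
      V.dom_self (V.idem_mul vc x.2.1 g.2.1),
      V.dom_self (V.idem_mul vc (V.idem_mul vc x.2.1 g.2.1) (V.idem_mul vc f.2 i.2))]
    exact V.inter_comm vc _ _ _ _
  cores_cores a f g x _ _ _ _ _ _ _ := by
    subst e
    change v (v a f.1) (v (v g.1 x.1) (V.inv (v g.1 x.1))) =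
      v (v a g.1) (v (v f.1 x.1) (V.inv (v f.1 x.1)))
    rw [V.dom_self (V.idem_mul vc g.2 x.2.1), V.dom_self (V.idem_mul vc f.2 x.2.1)]
    have : Std.Associative v := ⟨V.1⟩
    have : Std.Commutative v := ⟨vc⟩
    ac_rfl
  res_res a f g x _ _ _ _ _ _ _ := by
    subst e
    change v (v (v x.1 g.1) (V.inv (v x.1 g.1))) (v f.1 a) =
      v (v (v x.1 f.1) (V.inv (v x.1 f.1))) (v g.1 a)
    rw [V.dom_self (V.idem_mul vc x.2.1 g.2), V.dom_self (V.idem_mul vc x.2.1 f.2)]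
    have : Std.Associative v := ⟨V.1⟩
    have : Std.Commutative v := ⟨vc⟩
    ac_rfl
  meet_meet x f g i := by
    subst e
    exact Subtype.ext (V.dom_mul_dom_mul vc x.2.1 f.2.1 g.2.1 i.2.1)
  vdom_hmeet x f := by
    subst e; exact Subtype.ext (V.dom_mul vc x.1 f.1)
  vcod_hmeet x f := by
    subst e; exact Subtype.ext (V.cod_mul vc x.1 f.1)
  hdom_vmeet x f := by
    subst e; exact Subtype.ext (V.dom_mul vc x.1 f.1)
  hcod_vmeet x f := by
    subst e; exact Subtype.ext (V.cod_mul vc x.1 f.1)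
  vdom_hcores a x _ _ := by subst e; exact V.dom_mul vc a x.1
  vcod_hcores a x _ _ := by subst e; exact V.cod_mul vc a x.1
  vdom_hres x a _ _ := by subst e; exact V.dom_mul vc x.1 a
  vcod_hres x a _ _ := by subst e; exact V.cod_mul vc x.1 a
  hdom_vcores a x _ _ := by subst e; exact V.dom_mul vc a x.1
  hcod_vcores a x _ _ := by subst e; exact V.cod_mul vc a x.1
  hdom_vres x a _ _ := by subst e; exact V.dom_mul vc x.1 a
  hcod_vres x a _ _ := by subst e; exact V.cod_mul vc x.1 a

end

namespace DoubleInverseSemigroup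

/-- The double inductive groupoid of a double inverse semigroup. -/
noncomputable def toDoubleInductiveGroupoid (T : DoubleInverseSemigroup.{u}) :
    DoubleInductiveGroupoid.{u} :=
  semigroupDig T.h_inverse T.v_inverse T.h_comm T.v_comm T.v_eq_h

theorem Hom.idem_h {S T : DoubleInverseSemigroup.{u}} (φ : Hom S T) {x : S.S}
    (hx : S.h x x = x) : T.h (φ.f x) (φ.f x) = φ.f x := by
  rw [← φ.map_h, hx]

theorem Hom.idem_v {S T : DoubleInverseSemigroup.{u}} (φ : Hom S T) {x : S.S}
    (hx : S.v x x = x) : T.v (φ.f x) (φ.f x) = φ.f x := by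
  rw [← φ.map_v, hx]

theorem Hom.map_inv_h {S T : DoubleInverseSemigroup.{u}} (φ : Hom S T) (x : S.S) :
    φ.f (S.h_inverse.inv x) = T.h_inverse.inv (φ.f x) := by
  refine T.h_inverse.eq_inv ?_ ?_
  · rw [← φ.map_h, ← φ.map_h, S.h_inverse.mul_inv_mul]
  · rw [← φ.map_h, ← φ.map_h, S.h_inverse.inv_mul_inv]

theorem Hom.map_inv_v {S T : DoubleInverseSemigroup.{u}} (φ : Hom S T) (x : S.S) :
    φ.f (S.v_inverse.inv x) = T.v_inverse.inv (φ.f x) := by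
  refine T.v_inverse.eq_inv ?_ ?_
  · rw [← φ.map_v, ← φ.map_v, S.v_inverse.mul_inv_mul]
  · rw [← φ.map_v, ← φ.map_v, S.v_inverse.inv_mul_inv]

theorem Hom.map_dom_h {S T : DoubleInverseSemigroup.{u}} (φ : Hom S T) (x : S.S) :
    T.h (φ.f x) (T.h_inverse.inv (φ.f x)) = φ.f (S.h x (S.h_inverse.inv x)) := by
  rw [φ.map_h, φ.map_inv_h]

theorem Hom.map_cod_h {S T : DoubleInverseSemigroup.{u}} (φ : Hom S T) (x : S.S) :
    T.h (T.h_inverse.inv (φ.f x)) (φ.f x) = φ.f (S.h (S.h_inverse.inv x) x) := by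
  rw [φ.map_h, φ.map_inv_h]

theorem Hom.map_dom_v {S T : DoubleInverseSemigroup.{u}} (φ : Hom S T) (x : S.S) :
    T.v (φ.f x) (T.v_inverse.inv (φ.f x)) = φ.f (S.v x (S.v_inverse.inv x)) := by
  rw [φ.map_v, φ.map_inv_v]

theorem Hom.map_cod_v {S T : DoubleInverseSemigroup.{u}} (φ : Hom S T) (x : S.S) :
    T.v (T.v_inverse.inv (φ.f x)) (φ.f x) = φ.f (S.v (S.v_inverse.inv x) x) := by
  rw [φ.map_v, φ.map_inv_v]

end DoubleInverseSemigroup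

/-- The functor from double inverse semigroups to double inductive groupoids. -/
noncomputable def disToDig : DoubleInverseSemigroup.{u} ⥤ DoubleInductiveGroupoid.{u} where
  obj T := T.toDoubleInductiveGroupoid
  map {S T} φ :=
    { onObj := fun x => ⟨φ.f x.1, φ.idem_h x.2.1, φ.idem_v x.2.2⟩
      onVer := fun x => ⟨φ.f x.1, φ.idem_h x.2⟩
      onHor := fun x => ⟨φ.f x.1, φ.idem_v x.2⟩
      onDbl := φ.f
      ver :=
        { dom := fun a => Subtype.ext (φ.map_dom_v a.1)
          cod := fun a => Subtype.ext (φ.map_cod_v a.1)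
          id := fun _ => rfl
          comp := fun a b _ _ => Subtype.ext (φ.map_v a.1 b.1) }
      hor :=
        { dom := fun a => Subtype.ext (φ.map_dom_h a.1)
          cod := fun a => Subtype.ext (φ.map_cod_h a.1)
          id := fun _ => rfl
          comp := fun a b _ _ => Subtype.ext (φ.map_h a.1 b.1) }
      hdbl :=
        { dom := fun a => Subtype.ext (φ.map_dom_h a)
          cod := fun a => Subtype.ext (φ.map_cod_h a)
          id := fun _ => rfl
          comp := fun a b _ _ => φ.map_h a b }
      vdbl :=
        { dom := fun a => Subtype.ext (φ.map_dom_v a)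
          cod := fun a => Subtype.ext (φ.map_cod_v a)
          id := fun _ => rfl
          comp := fun a b _ _ => φ.map_v a b }
      hle := by
        rintro a b ⟨e, he, h⟩
        exact ⟨φ.f e, φ.idem_h he, by rw [h]; exact φ.map_h _ _⟩
      vle := by
        rintro a b ⟨e, he, h⟩
        exact ⟨φ.f e, φ.idem_v he, by rw [h]; exact φ.map_v _ _⟩
      hmeet := fun e f => Subtype.ext (φ.map_h e.1 f.1)
      vmeet := fun e f => Subtype.ext (φ.map_v e.1 f.1) }

end DoubleInverse

open DoubleInverse

/-!
All the cells of a double inductive groupoid `G` have their four corners equal, and its vertical and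
horizontal arrows are identities. So `G` is determined by its objects and by the groups `(A)S_G`:
every cell lies in exactly one of these groups, and the cell `a` is recovered from the pair
`(A, a)`. The two maps `(A, a) ↦ a` and `a ↦ (corner a, a)` are double inductive functors
(`DoubleInductiveGroupoid.fromPresheaf` and `DoubleInductiveGroupoid.intoPresheaf`), inverse to each
other; for the vertical structure this rests on the agreement of the two compositions
(Eckmann–Hilton), of the two orders and of the two meets. This gives `η`.

On the presheaf side, a morphism `(L, P) → (L', P')` is determined by one function between the
disjoint unions of the groups, and is an isomorphism as soon as that function is bijective
(`AbMeetSLatt.isIso_of_bijective_total`): the object function is then a bijection that preserves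
meets, so its inverse does too. A function `t` from the cells of `G` to `∐ AP` that is compatible
with corners, order and horizontal composition induces a morphism from `S_G` to `(L, P)`
(`DoubleInductiveGroupoid.presheafHom`). Both `ε` and the natural isomorphism at `(L, P)` for double
inverse semigroups come from `t = id`, since in both cases the cells of the double inductive
groupoid in question are the elements of `∐ AP`. In the second case the double inverse semigroup is
`∐ AP` with `a ⊗ b = a|_{A ∧ B} + b|_{A ∧ B}`, whose idempotents are the zeros of the groups `AP`.

At a double inverse semigroup `S`, the semigroup products of its double inductive groupoid are the
operations of `S` (`IsInverseOp.prod_ind`), so the functor `DIS → DIG → DIS` is isomorphic to the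
identity by maps that are the identity on elements; whiskering `η` does the rest.
-/

namespace DoubleInverse

/-! ### Isomorphisms of presheaves -/

namespace AbMeetSLatt

/-- A morphism of presheaves of Abelian groups on meet-semilattices is an isomorphism if the
function it induces on disjoint unions is bijective. -/
theorem isIso_of_bijective_total {X Y : AbMeetSLatt.{u}} (g : X ⟶ Y)
    (hg : Function.Bijective (Hom.total g)) : IsIso g := by
  -- the action on `L` is recovered from that on the zeros of the groups
  have hinj : Function.Injective (Hom.f g) := by
    intro A B h
    have : Hom.total g ⟨A, 0⟩ = Hom.total g ⟨B, 0⟩ := Total.ext h (by simp)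
    exact congrArg Sigma.fst (hg.1 this)
  have hsurj : Function.Surjective (Hom.f g) := by
    intro B
    obtain ⟨a, ha⟩ := hg.2 ⟨B, 0⟩
    exact ⟨a.1, congrArg Sigma.fst ha⟩
  have hψ : ∀ A, Function.Bijective (Hom.ψ g A) := by
    intro A
    constructor
    · intro a b h
      have : Hom.total g ⟨A, a⟩ = Hom.total g ⟨A, b⟩ := congrArg (Sigma.mk _) h
      simpa using hg.1 this
    · intro b
      obtain ⟨⟨A', a⟩, ha⟩ := hg.2 ⟨Hom.f g A, b⟩
      obtain rfl : A' = A := hinj (congrArg Sigma.fst ha)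
      exact ⟨a, by simpa using ha⟩
  let k : Y.L ≃ X.L := (Equiv.ofBijective _ ⟨hinj, hsurj⟩).symm
  have hk : ∀ B, Hom.f g (k B) = B := fun B =>
    (Equiv.ofBijective _ ⟨hinj, hsurj⟩).apply_symm_apply B
  let χ : ∀ A, Y.fiber (Hom.f g A) ≃+ X.fiber A := fun A =>
    (AddEquiv.ofBijective (Hom.ψ g A) (hψ A)).symm
  have hχ : ∀ A b, Hom.ψ g A (χ A b) = b := fun A b =>
    (AddEquiv.ofBijective (Hom.ψ g A) (hψ A)).apply_symm_apply b
  have kinf : ∀ A B, k (A ⊓ B) = k A ⊓ k B := fun A B =>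
    hinj (by rw [Hom.map_inf, hk, hk, hk])
  let i : Hom Y X :=
    { f := k
      mono := fun A B h => by rw [← inf_eq_left, ← kinf, inf_eq_left.2 h]
      map_inf := kinf
      ψ := fun B => (χ (k B)).toAddMonoidHom.comp (Y.res (hk B).le)
      comm := fun {A B} h b => (hψ _).1 (by
        rw [Hom.comm]
        change Hom.ψ g _ (χ _ _) = Y.res _ (Hom.ψ g _ (χ _ _))
        rw [hχ, hχ, res_res, res_res]) }
  have hi : ∀ b, Hom.total g (Hom.total i b) = b := fun b => Total.ext (hk b.1) (hχ _ _)
  refine ⟨i, Hom.ext_total fun A a => hg.1 ?_, Hom.ext_total fun A a => ?_⟩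
  · exact hi (Hom.total g ⟨A, a⟩)
  · exact hi ⟨A, a⟩

end AbMeetSLatt

/-! ### Morphisms out of the presheaf of a double inductive groupoid -/

namespace DoubleInductiveGroupoid

theorem corner_le_corner (G : DoubleInductiveGroupoid.{u}) {a b : G.Dbl} (h : G.hind.le a b) :
    G.corner a ≤ G.corner b := by
  have := G.hind.id_le h
  rwa [hdom_eq, hdom_eq] at this

/-- The morphism `S_G → (L, P)` induced by a function `t` from double cells to `∐ AP` that lies over
`f : Obj → L` and is compatible with the order and the horizontal composition. As `t a` lies over
`f A` only up to a propositional equality, it is transported by a restriction map along that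
equality. -/
def presheafHom (G : DoubleInductiveGroupoid.{u}) (X : AbMeetSLatt.{u}) (f : G.Obj → X.L)
    (t : G.Dbl → X.Total) (ht : ∀ a, (t a).1 = f (G.corner a))
    (hf : ∀ A B : G.Obj, f (A ⊓ B) = f A ⊓ f B)
    (hle : ∀ a b, G.hind.le a b → X.cellsInd.le (t a) (t b))
    (hcomp : ∀ a b h, t (G.hdbl.comp a b h) = X.mul (t a) (t b)) : G.toPresheaf ⟶ X :=
  have ht' : ∀ {A : G.Obj} (a : G.CellsAt A), f A = (t a.1).1 := fun a => by rw [ht, a.corner_eq]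
  { f := f
    mono := fun (A B : G.Obj) (h : A ≤ B) => by rw [← inf_eq_left, ← hf, inf_eq_left.2 h]
    map_inf := hf
    ψ := fun A => AddMonoidHom.mk' (fun a : G.CellsAt A => X.res (ht' a).le (t a.1).2) (by
      intro a b
      -- the second components of equal elements of `∐ AP` have equal restrictions
      have key : ∀ (x : X.Total) (B : X.L) (y : X.fiber B) (hx : B = x.1) (C) (h : C ≤ x.1),
        x = ⟨B, y⟩ → X.res h x.2 = X.res (h.trans hx.ge) y := by rintro _ B y - C h rfl; rfl
      have e := hcomp a.1 b.1 (G.hcomposable (a.corner_eq.trans b.corner_eq.symm))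
      have := key _ _ _ (congrArg Sigma.fst e).symm _ (ht' (a + b)).le e
      refine this.trans ?_
      rw [map_add, AbMeetSLatt.res_res, AbMeetSLatt.res_res])
    comm := fun {A B} h b => by
      obtain ⟨h', e⟩ := hle _ _ (CellsAt.restrict_le h b)
      change X.res _ (t (b.restrict h).1).2 = X.res _ (X.res _ (t b.1).2)
      rw [e]
      exact (X.res_res _ _ _).trans (X.res_res _ _ _).symm }

theorem presheafHom_total (G : DoubleInductiveGroupoid.{u}) (X : AbMeetSLatt.{u}) (f : G.Obj → X.L)
    (t : G.Dbl → X.Total) (ht hf hle hcomp) (A : G.Obj) (a : G.CellsAt A) :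
    AbMeetSLatt.Hom.total (G.presheafHom X f t ht hf hle hcomp) ⟨A, a⟩ = t a.1 :=
  AbMeetSLatt.Total.ext (by rw [ht, a.corner_eq]; rfl) rfl

theorem isIso_presheafHom (G : DoubleInductiveGroupoid.{u}) (X : AbMeetSLatt.{u}) (f : G.Obj → X.L)
    (t : G.Dbl → X.Total) (ht hf hle hcomp) (bij : Function.Bijective t) :
    IsIso (G.presheafHom X f t ht hf hle hcomp) := by
  refine AbMeetSLatt.isIso_of_bijective_total _ ⟨?_, fun b => ?_⟩
  · rintro ⟨A, a⟩ ⟨B, b⟩ h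
    have h := (presheafHom_total G X f t ht hf hle hcomp A a).symm.trans
      (h.trans (presheafHom_total G X f t ht hf hle hcomp B b))
    exact (G.toTotal_val (A := A) a).symm.trans
      ((congrArg G.toTotal (bij.1 h)).trans (G.toTotal_val (A := B) b))
  · obtain ⟨a, rfl⟩ := bij.2 b
    exact ⟨G.toTotal a, presheafHom_total ..⟩

/-! ### A double inductive groupoid is that of its presheaf -/

/-- The double inductive functor from `∐ (A)S_G` to `G` that sends `(A, a)` to `a`. -/
def fromPresheaf (G : DoubleInductiveGroupoid.{u}) : presheafToDig.obj G.toPresheaf ⟶ G where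
  onObj A := A
  onVer A := G.ver.id A
  onHor A := G.hor.id A
  onDbl a := (a.2 : G.CellsAt a.1).1
  ver := ⟨G.ver.dom_id, G.ver.cod_id, fun _ => rfl, fun A B h h' => by
    obtain rfl : A = B := h
    exact (G.ver.id_comp (G.ver.id A) (G.ver.cod_id _)).symm.trans
      (G.ver.comp_congr (congrArg G.ver.id (G.ver.dom_id A)) rfl _ _)⟩
  hor := ⟨G.hor.dom_id, G.hor.cod_id, fun _ => rfl, fun A B h h' => by
    obtain rfl : A = B := h
    exact (G.hor.id_comp (G.hor.id A) (G.hor.cod_id _)).symm.trans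
      (G.hor.comp_congr (congrArg G.hor.id (G.hor.dom_id A)) rfl _ _)⟩
  hdbl := ⟨fun a => by rw [hdom_eq, (a.2 : G.CellsAt a.1).corner_eq]; rfl,
    fun a => by rw [hcod_eq, (a.2 : G.CellsAt a.1).corner_eq]; rfl, fun _ => rfl,
    by
      rintro ⟨A, a⟩ ⟨B, b⟩ h h'
      obtain rfl : A = B := h
      have : G.toPresheaf.res (le_refl A) b = b := AbMeetSLatt.res_refl _ _ _
      change (a + G.toPresheaf.res (le_refl A) b : G.CellsAt A).1 = _
      rw [this]; rfl⟩
  vdbl := ⟨fun a => by rw [vdom_eq, (a.2 : G.CellsAt a.1).corner_eq]; rfl,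
    fun a => by rw [vcod_eq, (a.2 : G.CellsAt a.1).corner_eq]; rfl, fun A => G.hid_id A,
    by
      rintro ⟨A, a⟩ ⟨B, b⟩ h h'
      obtain rfl : A = B := h
      have : G.toPresheaf.res (le_refl A) b = b := AbMeetSLatt.res_refl _ _ _
      change (a + G.toPresheaf.res (le_refl A) b : G.CellsAt A).1 = _
      rw [this]
      exact congrArg Subtype.val (CellsAt.vadd_eq_add (A := A) a b).symm⟩
  hle := by
    rintro ⟨A, a⟩ ⟨B, b⟩ ⟨h, e⟩
    exact (congrArg (fun c : G.CellsAt A => G.hind.le c.1 (b : G.CellsAt B).1) e).mpr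
      (CellsAt.restrict_le h b)
  vle := by
    rintro ⟨A, a⟩ ⟨B, b⟩ ⟨h, e⟩
    exact (congrArg (fun c : G.CellsAt A => G.vind.le c.1 (b : G.CellsAt B).1) e).mpr
      (G.vle_of_hle (CellsAt.restrict_le h b))
  hmeet A B := (G.meetH_id A B).symm
  vmeet A B := (congrArg G.hor.id (G.objMeetH_eq_objMeetV A B)).trans (G.meetV_id A B).symm

/-- The double inductive functor from `G` to `∐ (A)S_G` that sends a cell to itself, placed in the
summand of its corner. -/
def intoPresheaf (G : DoubleInductiveGroupoid.{u}) : G ⟶ presheafToDig.obj G.toPresheaf where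
  onObj A := A
  onVer e := G.ver.dom e
  onHor f := G.hor.dom f
  onDbl := G.toTotal
  ver := ⟨fun _ => rfl, fun e => by rw [G.ver_eq_id e, G.ver.cod_id, G.ver.dom_id]; rfl,
    G.ver.dom_id, fun a b h h' => G.ver.dom_comp a b h⟩
  hor := ⟨fun _ => rfl, fun e => by rw [G.hor_eq_id e, G.hor.cod_id, G.hor.dom_id]; rfl,
    G.hor.dom_id, fun a b h h' => G.hor.dom_comp a b h⟩
  hdbl := ⟨fun _ => rfl, fun a => by rw [hcod_eq, G.ver.dom_id]; rfl,
    fun e => by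
      rw [G.ver_eq_id e, G.ver.dom_id]; exact G.toTotal_val (0 : G.CellsAt _),
    fun a b h h' =>
      G.toTotal_comp rfl (G.toTotal_of_le (G.hind.le_refl b) (Eq.symm h') (le_of_eq h')) _⟩
  vdbl := ⟨fun a => by rw [vdom_eq, G.hor.dom_id]; rfl, fun a => by rw [vcod_eq, G.hor.dom_id]; rfl,
    fun e => by
      rw [G.hor_eq_id e, G.hor.dom_id, ← G.hid_id]; exact G.toTotal_val (0 : G.CellsAt _),
    fun a b h h' =>
      G.toTotal_vcomp rfl (G.toTotal_of_le (G.hind.le_refl b) (Eq.symm h') (le_of_eq h')) _⟩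
  hle a b h := ⟨G.corner_le_corner h,
    CellsAt.eq_restrict (G.corner_le_corner h) (.mk b rfl) (.mk a rfl) h⟩
  vle a b h := ⟨G.corner_le_corner (G.hle_of_vle h),
    CellsAt.eq_restrict (G.corner_le_corner (G.hle_of_vle h)) (.mk b rfl) (.mk a rfl)
      (G.hle_of_vle h)⟩
  hmeet e f := by
    rw [G.ver_eq_id e, G.ver_eq_id f, meetH_id]; simp only [G.ver.dom_id]; rfl
  vmeet e f := by
    rw [G.hor_eq_id e, G.hor_eq_id f, meetV_id]
    simp only [G.hor.dom_id, ← objMeetH_eq_objMeetV]; rfl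

end DoubleInductiveGroupoid

/-- The natural isomorphism between presheaves regarded back as double inductive groupoids and the
original double inductive groupoids, with components `(A, a) ↦ a`. -/
def digIso : digToPresheaf.{u} ⋙ presheafToDig.{u} ≅ 𝟭 DoubleInductiveGroupoid.{u} :=
  NatIso.ofComponents
    (fun G =>
      { hom := G.fromPresheaf
        inv := G.intoPresheaf
        hom_inv_id := DoubleInductiveFunctor.ext rfl (funext G.ver.dom_id) (funext G.hor.dom_id)
          (funext fun a => G.toTotal_val (A := a.1) a.2)
        inv_hom_id := DoubleInductiveFunctor.ext rfl (funext fun e => (G.ver_eq_id e).symm)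
          (funext fun f => (G.hor_eq_id f).symm) rfl })
    (fun F => DoubleInductiveFunctor.ext rfl (funext fun A => (F.ver.id A).symm)
      (funext fun A => (F.hor.id A).symm) rfl)

/-! ### A presheaf is that of its double inductive groupoid -/

namespace AbMeetSLatt

/-- Composition is the restriction of the product of `∐ AP` to composable pairs. -/
theorem comp_eq_mul (X : AbMeetSLatt.{u}) (a b : X.Total) (h) : X.cells.comp a b h = X.mul a b :=
  Total.ext (inf_eq_left.2 (le_of_eq h)).symm (by rw [map_add, res_res, res_res, res_refl])

/-- The morphism to `(L, P)` from the presheaf of its double inductive groupoid that is the identity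
on `L` and sends the cell of `a ∈ AP` to `a`. -/
def fromCells (X : AbMeetSLatt.{u}) : digToPresheaf.obj (presheafToDig.obj X) ⟶ X :=
  (presheafToDig.obj X).presheafHom X (fun A => A) (fun a => a) (fun _ => rfl) (fun _ _ => rfl)
    (fun _ _ h => h) X.comp_eq_mul

theorem total_fromCells (X : AbMeetSLatt.{u}) (A : X.L) (a : (presheafToDig.obj X).CellsAt A) :
    Hom.total X.fromCells ⟨A, a⟩ = a.1 :=
  DoubleInductiveGroupoid.presheafHom_total ..

theorem isIso_fromCells (X : AbMeetSLatt.{u}) : IsIso X.fromCells :=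
  DoubleInductiveGroupoid.isIso_presheafHom _ _ _ _ _ _ _ _ Function.bijective_id

/-- The natural isomorphism between the presheaf of cells of the double inductive groupoid of a
presheaf and that presheaf, with components `fromCells`. -/
noncomputable def presheafIso : presheafToDig.{u} ⋙ digToPresheaf.{u} ≅ 𝟭 AbMeetSLatt.{u} :=
  NatIso.ofComponents (fun X => @asIso _ _ _ _ X.fromCells X.isIso_fromCells)
    (fun {X Y} g => Hom.ext_total fun A a =>
      (total_fromCells Y _ (DoubleInductiveGroupoid.CellsAt.map (presheafToDig.map g) A a)).trans
        (congrArg (Hom.total g) (total_fromCells X A a)).symm)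

/-! ### A presheaf is that of its double inverse semigroup -/

theorem prod_eq_mul (X : AbMeetSLatt.{u}) (a b : X.Total) : X.cellsInd.prod a b = X.mul a b :=
  Total.ext rfl (by
    change X.res _ a.2 + X.res _ (X.res _ b.2) = X.res _ (X.res _ a.2 + X.res _ b.2)
    rw [map_add, res_res, res_res])

theorem isInverseOp_prod (X : AbMeetSLatt.{u}) : IsInverseOp X.cellsInd.prod :=
  (digToDis.obj (presheafToDig.obj X)).h_inverse

/-- An inverse semigroup operation on `∐ AP` lying over the meet of `L` has inverses over the
identity of `L`. -/
theorem fst_inv (X : AbMeetSLatt.{u}) {m : X.Total → X.Total → X.Total}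
    (hm : ∀ a b, (m a b).1 = a.1 ⊓ b.1) (H : IsInverseOp m) (a : X.Total) : (H.inv a).1 = a.1 := by
  have h1 := congrArg Sigma.fst (H.mul_inv_mul a)
  have h2 := congrArg Sigma.fst (H.inv_mul_inv a)
  rw [hm, hm] at h1 h2
  refine le_antisymm ?_ ?_
  · rw [← h2]; exact inf_le_left.trans inf_le_right
  · rw [← h1]; exact inf_le_left.trans inf_le_right

theorem fst_dom (X : AbMeetSLatt.{u}) {m : X.Total → X.Total → X.Total}
    (hm : ∀ a b, (m a b).1 = a.1 ⊓ b.1) (H : IsInverseOp m) (a : X.Total) :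
    (m a (H.inv a)).1 = a.1 := by
  rw [hm, X.fst_inv hm, inf_idem]

/-- The only idempotents of `∐ AP` are the zeros of the groups `AP`. -/
theorem snd_eq_zero (X : AbMeetSLatt.{u}) {a : X.Total} (h : X.mul a a = a) : a.2 = 0 := by
  obtain ⟨A, a⟩ := a
  have e : X.mul ⟨A, a⟩ ⟨A, a⟩ = ⟨A, a + a⟩ :=
    Total.ext (inf_idem A) (map_add _ a a).symm
  have := e.symm.trans h
  simpa using this

/-- The order of the inverse semigroup `∐ AP` is contained in that of the double inductive groupoid
`∐ AP`. -/
theorem mul_le_right (X : AbMeetSLatt.{u}) {e : X.Total} (he : X.mul e e = e) (b : X.Total) :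
    X.cellsInd.le (X.mul e b) b :=
  ⟨inf_le_right, by
    change X.res _ e.2 + X.res _ b.2 = _
    rw [X.snd_eq_zero he, map_zero, zero_add]⟩

/-- The morphism to `(L, P)` from the presheaf of its double inverse semigroup that sends the
idempotent `0 ∈ AP` to `A` and the cell of `a ∈ AP` to `a`. -/
noncomputable def fromSemigroup (X : AbMeetSLatt.{u}) :
    digToPresheaf.obj (disToDig.obj (digToDis.obj (presheafToDig.obj X))) ⟶ X :=
  (disToDig.obj (digToDis.obj (presheafToDig.obj X))).presheafHom X (fun e => (e.1 : X.Total).1)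
    (fun a => a)
    (fun a => ((X.fst_dom (fun _ _ => rfl) X.isInverseOp_prod _).trans
      (X.fst_dom (fun _ _ => rfl) X.isInverseOp_prod a)).symm)
    (fun e f => X.fst_dom (fun _ _ => rfl) X.isInverseOp_prod (X.cellsInd.prod e.1 f.1))
    (fun a b => by
      rintro ⟨e, he, rfl⟩
      exact (congrArg (X.cellsInd.le · b) (X.prod_eq_mul e b)).mpr
        (X.mul_le_right ((X.prod_eq_mul e e).symm.trans he) b))
    (fun a b _ => X.prod_eq_mul a b)

theorem total_fromSemigroup (X : AbMeetSLatt.{u})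
    (e : (disToDig.obj (digToDis.obj (presheafToDig.obj X))).Obj)
    (a : (disToDig.obj (digToDis.obj (presheafToDig.obj X))).CellsAt e) :
    Hom.total X.fromSemigroup ⟨e, a⟩ = a.1 :=
  DoubleInductiveGroupoid.presheafHom_total ..

theorem isIso_fromSemigroup (X : AbMeetSLatt.{u}) : IsIso X.fromSemigroup :=
  DoubleInductiveGroupoid.isIso_presheafHom _ _ _ _ _ _ _ _ Function.bijective_id

/-- The natural isomorphism between the presheaf of the double inverse semigroup of a presheaf and
that presheaf, with components `fromSemigroup`. -/
noncomputable def presheafIsoSemigroup :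
    (presheafToDig.{u} ⋙ digToDis.{u}) ⋙ (disToDig.{u} ⋙ digToPresheaf.{u}) ≅
      𝟭 AbMeetSLatt.{u} :=
  NatIso.ofComponents (fun X => @asIso _ _ _ _ X.fromSemigroup X.isIso_fromSemigroup)
    (fun {X Y} g => Hom.ext_total fun A a =>
      (total_fromSemigroup Y _ (DoubleInductiveGroupoid.CellsAt.map
        (disToDig.map (digToDis.map (presheafToDig.map g))) A a)).trans
        (congrArg (Hom.total g) (total_fromSemigroup X A a)).symm)

end AbMeetSLatt

/-! ### A double inverse semigroup is that of its double inductive groupoid -/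

/-- The semigroup product of the inductive groupoid of a commutative inverse semigroup is the
original operation: with `e = a⁻¹a bb⁻¹`, one has `(ae)(eb) = (aa⁻¹a)(bb⁻¹b)`. -/
theorem IsInverseOp.prod_ind {S : Type u} {m : S → S → S} (H : IsInverseOp m)
    (comm : ∀ a b, m a b = m b a) (a b : S) : (H.ind comm).prod a b = m a b := by
  have he := H.idem_mul comm (H.cod_idem a) (H.dom_idem b)
  change m (m a (m (m (H.inv a) a) (m b (H.inv b)))) (m (m (m (H.inv a) a) (m b (H.inv b))) b) = _
  calc
    _ = m (m a (m (m (m (H.inv a) a) (m b (H.inv b))) (m (m (H.inv a) a) (m b (H.inv b))))) b := by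
      simp only [H.1]
    _ = m (m (m a (H.inv a)) a) (m (m b (H.inv b)) b) := by rw [he]; simp only [H.1]
    _ = m a b := by rw [H.mul_inv_mul, H.mul_inv_mul]

namespace DoubleInverseSemigroup

theorem prod_h (T : DoubleInverseSemigroup.{u}) (a b : T.S) :
    (disToDig.obj T).hind.prod a b = T.h a b :=
  T.h_inverse.prod_ind T.h_comm a b

theorem prod_v (T : DoubleInverseSemigroup.{u}) (a b : T.S) :
    (disToDig.obj T).vind.prod a b = T.v a b :=
  T.v_inverse.prod_ind T.v_comm a b

/-- The natural isomorphism, the identity on elements, between the double inverse semigroup of the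
double inductive groupoid of a double inverse semigroup and that double inverse semigroup. -/
noncomputable def disIso : disToDig.{u} ⋙ digToDis.{u} ≅ 𝟭 DoubleInverseSemigroup.{u} :=
  NatIso.ofComponents
    (fun T =>
      { hom := ⟨fun a => a, T.prod_h, T.prod_v⟩
        inv := ⟨fun a => a, fun a b => (T.prod_h a b).symm, fun a b => (T.prod_v a b).symm⟩
        hom_inv_id := rfl
        inv_hom_id := rfl })
    (fun _ => rfl)

end DoubleInverseSemigroup

end DoubleInverse

/-- The functors `digToPresheaf` and `presheafToDig` are mutually inverse, the only difference
between their composites and the identities being the canonical relabelling: it fixes all objects,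
and matches a double cell `a` with all corners `A` with the element `a` of the `A`-th summand of the
disjoint union. Composing with the functors between double inductive groupoids and double inverse
semigroups, double inverse semigroups are exactly presheaves of Abelian groups on
meet-semilattices, in the same sense. -/
theorem mainTheorem3 :
    (∃ (η : digToPresheaf.{u} ⋙ presheafToDig.{u} ≅ 𝟭 DoubleInductiveGroupoid.{u})
        (ε : presheafToDig.{u} ⋙ digToPresheaf.{u} ≅ 𝟭 AbMeetSLatt.{u}),
      (∀ (G : DoubleInductiveGroupoid.{u}) (A : G.Obj),
        (η.hom.app G).onObj A = A ∧ (η.hom.app G).onVer A = G.ver.id A ∧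
          (η.hom.app G).onHor A = G.hor.id A) ∧
      (∀ (G : DoubleInductiveGroupoid.{u}) (A : G.Obj) (a : G.CellsAt A),
        (η.hom.app G).onDbl ⟨A, a⟩ = a.1) ∧
      (∀ (X : AbMeetSLatt.{u}) (A : X.L), (ε.hom.app X).f A = A) ∧
      (∀ (X : AbMeetSLatt.{u}) (A : X.L) (a : (presheafToDig.obj X).CellsAt A),
        (⟨(ε.hom.app X).f A, (ε.hom.app X).ψ A a⟩ : X.Total) = a.1)) ∧
    (∃ (θ : (disToDig.{u} ⋙ digToPresheaf.{u}) ⋙ (presheafToDig.{u} ⋙ digToDis.{u}) ≅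
          𝟭 DoubleInverseSemigroup.{u})
        (ζ : (presheafToDig.{u} ⋙ digToDis.{u}) ⋙ (disToDig.{u} ⋙ digToPresheaf.{u}) ≅
          𝟭 AbMeetSLatt.{u}),
      (∀ (T : DoubleInverseSemigroup.{u}) (e : (disToDig.obj T).Obj)
        (a : (disToDig.obj T).CellsAt e), (θ.hom.app T).f ⟨e, a⟩ = a.1) ∧
      (∀ (X : AbMeetSLatt.{u})
        (e : (disToDig.obj (digToDis.obj (presheafToDig.obj X))).Obj)
        (a : (disToDig.obj (digToDis.obj (presheafToDig.obj X))).CellsAt e),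
        (ζ.hom.app X).f e = (e.1 : X.Total).1 ∧
          (⟨(ζ.hom.app X).f e, (ζ.hom.app X).ψ e a⟩ : X.Total) = a.1)) := by
  refine ⟨⟨digIso, AbMeetSLatt.presheafIso, fun _ _ => ⟨rfl, rfl, rfl⟩, fun _ _ _ => rfl,
    fun _ _ => rfl, fun X => X.total_fromCells⟩,
    Functor.isoWhiskerRight (Functor.isoWhiskerLeft disToDig digIso) digToDis ≪≫
      DoubleInverseSemigroup.disIso,
    AbMeetSLatt.presheafIsoSemigroup, fun _ _ _ => rfl,
    fun X e a => ⟨rfl, X.total_fromSemigroup e a⟩⟩
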